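/- For a finite group $X$, let the commuting graph $\Delta(X)$ be the graph with vertex set $X\setminus\{1\}$ in which two distinct vertices $a,b$ are joined by an edge if and only if $ab=ba$. Let $d$ denote the graph distance on $\Delta(X)$ and $\operatorname{diam}(\Delta(X))$ the supremum of all distances, with $d(a,b)=\infty$ if $a$ and $b$ lie in different connected components. Call $\Delta(X)$ balanced if there are vertices $x,y$ such that $xy$ and $x^{-1}y$ are also vertices and the distances $d(x,y)$, $d(x,xy)$, $d(y,xy)$, $d(x,x^{-1}y)$, $d(y,x^{-1}y)$ are all greater than $3$. **Theorem A.** Let $L$ be a nonabelian finite simple group. Suppose that $\operatorname{diam}(\Delta(L))>4$ or that $\Delta(L)$ is balanced. Let $D$ be a finite-dimensional division algebra over an arbitrary field, and let $D^{\#}=D\setminus\{0\}$ be its multiplicative group. Then $D^{\#}$ has no normal subgroup $N$ such that $D^{\#}/N\cong L$. -/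

import Mathlib

/-- The commuting graph of a group `X`: its vertices are the nonidentity elements of `X`, and two
distinct vertices are adjacent exactly when they commute in `X`. -/
def commutingGraph (X : Type*) [Group X] : SimpleGraph {g : X // g ≠ 1} where
  Adj a b := a ≠ b ∧ Commute (a : X) (b : X)
  symm := ⟨fun _ _ h => ⟨h.1.symm, h.2.symm⟩⟩
  loopless := ⟨fun _ h => h.1 rfl⟩

/-- The commuting graph of `X` is balanced: there are vertices `x`, `y` such that `x * y` and
`x⁻¹ * y` are vertices too and the distances `d(x, y)`, `d(x, xy)`, `d(y, xy)`, `d(x, x⁻¹y)`,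
`d(y, x⁻¹y)` all exceed `3`. The distance is the extended one: it is infinite between
different connected components. (If `x * y` or `x⁻¹ * y` is the identity, then `x` and `y` commute
and `d(x, y) ≤ 1`, so requiring them to be vertices is no additional restriction.) -/
def CommutingGraphBalanced (X : Type*) [Group X] : Prop :=
  ∃ (x y : {g : X // g ≠ 1}) (hm : (x : X) * (y : X) ≠ 1) (hd : (x : X)⁻¹ * (y : X) ≠ 1),
    3 < (commutingGraph X).edist x y ∧
    3 < (commutingGraph X).edist x ⟨(x : X) * (y : X), hm⟩ ∧
    3 < (commutingGraph X).edist y ⟨(x : X) * (y : X), hm⟩ ∧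
    3 < (commutingGraph X).edist x ⟨(x : X)⁻¹ * (y : X), hd⟩ ∧
    3 < (commutingGraph X).edist y ⟨(x : X)⁻¹ * (y : X), hd⟩

/-! Write N for the kernel of `π : D →*₀ WithZero L`, the extension by zero of a supposed surjection
onto `L`, and S(a) for `shiftSet π a`. Addition meets the commuting graph in `commute_map_add`: for
n in N, a + n = n (n⁻¹a + 1), so π(a + n) commutes with π(a). If S(a) and S(b) are incomparable,
such sums spell out a short path from x = π(a) to y = π(b), or from one of them to x⁻¹y, or else
force x = y. The graph hypotheses exclude this for a suitable pair (x, y), so over that pair all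
S(a) and S(b) are comparable.

The action of N on these inclusions then defines a total two-sided invariant preorder on N. As N has
finite index and contains the nonzero center, N - N = D (`exists_eq_sub_of_map_eq_one`). This makes
the preorder nontrivial, and if R is the ring generated by its nonnegative elements, then 1 + kR ⊆ N
for some k in N (`IsIncidentPair.exists_map_one_add_mul`). Finite dimension enters only through
`BoundedOverCenter`. It allows k to be replaced by a central e for which R is a valuation ring up to
factors of e (`IsScale`).

If R[1/e] ≠ D, intersecting the localizations at all scales gives a proper conjugation invariant
valuation ring whose nonunits t satisfy 1 + t ∈ N. If R[1/e] = D, homogenizing the order along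
powers of e gives a real valuation. The same property of its ring follows because commutators of
elements 1 + t of level c have level 2c, high levels lie in N, and `L` is perfect.

The contradiction is a descent. The residue division ring of an invariant valuation ring is again
bounded over its center, and its multiplicative group still maps onto `L`, since the value group is
commutative. It therefore has a proper invariant valuation ring, whose preimage is strictly smaller
(`IsInvariantValuationRing.exists_lt`). Conjugations of D act on the residue ring by automorphisms
that need not be inner, so stability under automorphisms preserving π is carried along. Zorn's lemma
provides a minimal invariant valuation ring, which cannot exist. -/

/-- Any `d + 1` elements of the division ring are linearly dependent over its center, for some
fixed `d`. -/
def BoundedOverCenter (D : Type*) [DivisionRing D] : Prop :=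
  ∃ d : ℕ, ∀ t : Fin (d + 1) → D, ∃ c : Fin (d + 1) → D,
    (∀ i, c i ∈ Set.center D) ∧ c ≠ 0 ∧ ∑ i, c i * t i = 0

/-! ### Shift sets and paths in the commuting graph -/

section ShiftSet

variable {D H : Type*} [DivisionRing D] [GroupWithZero H] (π : D →*₀ H)

/-- The elements `n` of the kernel of `π` for which `a + n` lies in the kernel too. -/
def shiftSet (a : D) : Set D := {n | π n = 1 ∧ π (a + n) = 1}

variable {π}

lemma ne_zero_of_map_eq_one {n : D} (hn : π n = 1) : n ≠ 0 := by
  rintro rfl; simp at hn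

lemma ne_zero_of_map_ne_zero {a : D} (ha : π a ≠ 0) : a ≠ 0 := by
  rintro rfl; simp at ha

lemma map_inv_eq_one {n : D} (hn : π n = 1) : π n⁻¹ = 1 := by simp [hn]

lemma map_neg_eq (h : π (-1) = 1) (a : D) : π (-a) = π a := by
  rw [← neg_one_mul, map_mul, h, one_mul]

/-- Modulo the kernel, a + n is n⁻¹a + 1, which commutes with n⁻¹a, and n⁻¹a has the same image as
a. This is the source of all edges of the commuting graph used below. -/
lemma commute_map_add {n : D} (hn : π n = 1) (a : D) : Commute (π (a + n)) (π a) := by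
  have hn0 := ne_zero_of_map_eq_one hn
  have h1 : a + n = n * (n⁻¹ * a + 1) := by rw [mul_add, mul_inv_cancel_left₀ hn0, mul_one]
  have h2 : π (a + n) = π (n⁻¹ * a + 1) := by rw [h1, map_mul, hn, one_mul]
  have h3 : π a = π (n⁻¹ * a) := by simp [hn]
  rw [h2, h3]
  exact ((Commute.refl (n⁻¹ * a)).add_left (Commute.one_left _)).map π

lemma mul_mem_shiftSet_mul_left {m : D} (hm : π m = 1) {n a : D} :
    m * n ∈ shiftSet π (m * a) ↔ n ∈ shiftSet π a := by
  simp [shiftSet, ← mul_add, hm]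

lemma mul_mem_shiftSet_mul_right {m : D} (hm : π m = 1) {n a : D} :
    n * m ∈ shiftSet π (a * m) ↔ n ∈ shiftSet π a := by
  simp [shiftSet, ← add_mul, hm]

lemma shiftSet_mul_left_subset {m : D} (hm : π m = 1) {a b : D}
    (h : shiftSet π a ⊆ shiftSet π b) : shiftSet π (m * a) ⊆ shiftSet π (m * b) := by
  have hm0 := ne_zero_of_map_eq_one hm
  intro n hn
  rw [← mul_inv_cancel_left₀ hm0 n, mul_mem_shiftSet_mul_left hm] at hn ⊢
  exact h hn

lemma shiftSet_mul_right_subset {m : D} (hm : π m = 1) {a b : D}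
    (h : shiftSet π a ⊆ shiftSet π b) : shiftSet π (a * m) ⊆ shiftSet π (b * m) := by
  have hm0 := ne_zero_of_map_eq_one hm
  intro n hn
  rw [← inv_mul_cancel_right₀ hm0 n, mul_mem_shiftSet_mul_right hm] at hn ⊢
  exact h hn

lemma one_mem_shiftSet_inv_mul {m a : D} (hm : π m = 1) :
    1 ∈ shiftSet π (m⁻¹ * a) ↔ m ∈ shiftSet π a := by
  have hm0 := ne_zero_of_map_eq_one hm
  rw [← mul_mem_shiftSet_mul_left hm, mul_inv_cancel_left₀ hm0, mul_one]

/-- If no nontrivial element commutes with both `x` and `y` and no path of length four joins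
them, then shift sets of representatives of `x` and `y` are comparable. -/
lemma shiftSet_incident_of_four {x y : H} (hneg : π (-1) = 1) (hxy : ¬ Commute x y)
    (hx : x ≠ 1) (hy : y ≠ 1)
    (hfar : ∀ u v w : H, u ≠ 0 → u ≠ 1 → v ≠ 0 → v ≠ 1 → w ≠ 0 → w ≠ 1 →
      Commute x u → Commute u v → Commute v w → Commute w y → False)
    {a b : D} (ha : π a = x) (hb : π b = y) :
    shiftSet π a ⊆ shiftSet π b ∨ shiftSet π b ⊆ shiftSet π a := by
  by_contra! hcon
  obtain ⟨h1, h2⟩ := hcon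
  obtain ⟨n, hna, hnb⟩ := Set.not_subset.1 h1
  obtain ⟨m, hmb, hma⟩ := Set.not_subset.1 h2
  have hn := hna.1
  have hm := hmb.1
  have key : ∀ {c k : D}, π c ≠ 1 → π k = 1 → k ∉ shiftSet π c →
      π (c + k) ≠ 0 ∧ π (c + k) ≠ 1 := by
    intro c k hc hk hck
    refine ⟨fun h => ?_, fun h => hck ⟨hk, h⟩⟩
    have : c = -k := by rw [map_eq_zero] at h; exact eq_neg_of_add_eq_zero_left h
    rw [this, map_neg_eq hneg, hk] at hc
    exact hc rfl
  have hw := key (ha ▸ hx) hm hma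
  have hc := key (hb ▸ hy) hn hnb
  have hz0 : π (a - b) ≠ 0 := by
    rw [Ne, map_eq_zero, sub_eq_zero]
    rintro rfl
    exact hxy (ha ▸ hb ▸ Commute.refl _)
  -- The path is x, π(a + m), π(a - b), π(b + n), y: up to sign, a - b differs from a + m by b + m
  -- and from b + n by a + n, both in the kernel.
  have e1 : a - b = (a + m) + -(b + m) := by abel
  have e2 : a - b = -((b + n) + -(a + n)) := by abel
  have c1 : Commute (π (a - b)) (π (a + m)) := by
    rw [e1]; exact commute_map_add (by rw [map_neg_eq hneg]; exact hmb.2) _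
  have c2 : Commute (π (a - b)) (π (b + n)) := by
    rw [e2, map_neg_eq hneg]
    exact commute_map_add (by rw [map_neg_eq hneg]; exact hna.2) _
  have c0 : Commute x (π (a + m)) := ha ▸ (commute_map_add hm a).symm
  have c3 : Commute (π (b + n)) y := hb ▸ commute_map_add hn b
  have hz1 : π (a - b) ≠ 1 := by
    intro h
    have h3 : Commute (π a) (π b) := by
      have := commute_map_add h b
      rwa [add_sub_cancel] at this
    exact hxy (ha ▸ hb ▸ h3)
  exact hfar _ _ _ hw.1 hw.2 hz0 hz1 hc.1 hc.2 c0 c1.symm c2 c3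

/-- For m in S(b) outside S(a), the path x, π(a + m), π(a⁻¹(a - b)), x⁻¹y has length three; it
breaks down only if its third vertex is 1. The last edge comes from a⁻¹(a - b) = 1 - a⁻¹b. -/
lemma map_sub_eq_of_not_subset {x y : H} (hneg : π (-1) = 1) (hxy : ¬ Commute x y)
    (hx : x ≠ 1)
    (hfar : ∀ u v : H, u ≠ 0 → u ≠ 1 → v ≠ 0 → v ≠ 1 →
      Commute x u → Commute u v → Commute v (x⁻¹ * y) → False)
    {a b : D} (ha : π a = x) (hb : π b = y) (h : ¬ shiftSet π b ⊆ shiftSet π a) :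
    π (a - b) = x := by
  obtain ⟨m, hmb, hma⟩ := Set.not_subset.1 h
  have hm := hmb.1
  have hx0 : x ≠ 0 := by rintro rfl; exact hxy (Commute.zero_left _)
  have ha0 : a ≠ 0 := ne_zero_of_map_ne_zero (ha ▸ hx0)
  have hw0 : π (a + m) ≠ 0 := by
    intro h0
    have : a = -m := by rw [map_eq_zero] at h0; exact eq_neg_of_add_eq_zero_left h0
    rw [this, map_neg_eq hneg, hm] at ha
    exact hx ha.symm
  have hw1 : π (a + m) ≠ 1 := fun h1 => hma ⟨hm, h1⟩
  have hz0 : π (a - b) ≠ 0 := by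
    rw [Ne, map_eq_zero, sub_eq_zero]
    rintro rfl
    exact hxy (ha ▸ hb ▸ Commute.refl _)
  have e1 : a - b = (a + m) + -(b + m) := by abel
  have c1 : Commute (π (a - b)) (π (a + m)) := by
    rw [e1]; exact commute_map_add (by rw [map_neg_eq hneg]; exact hmb.2) _
  have c0 : Commute x (π (a + m)) := ha ▸ (commute_map_add hm a).symm
  by_contra hne
  have he : π (a⁻¹ * (a - b)) = x⁻¹ * π (a - b) := by rw [map_mul, map_inv₀, ha]
  refine hfar _ (π (a⁻¹ * (a - b))) hw0 hw1 ?_ ?_ c0 ?_ ?_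
  · rw [he]; exact mul_ne_zero (inv_ne_zero hx0) hz0
  · rw [he]
    intro h1
    exact hne ((inv_mul_eq_one₀ hx0).1 h1).symm
  · rw [he]
    exact (c0.symm.inv_right₀).mul_right c1.symm
  · have e2 : a⁻¹ * (a - b) = -(a⁻¹ * b) + 1 := by
      rw [mul_sub, inv_mul_cancel₀ ha0]; abel
    have := commute_map_add (π := π) (map_one π) (-(a⁻¹ * b))
    rw [e2]
    rwa [map_neg_eq hneg (a⁻¹ * b), map_mul π a⁻¹ b, map_inv₀, ha, hb] at this

/-- If no path of length three joins `x` or `y` to `x⁻¹ * y`, then shift sets of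
representatives of `x` and `y` are comparable. -/
lemma shiftSet_incident_of_three {x y : H} (hneg : π (-1) = 1) (hxy : ¬ Commute x y)
    (hx : x ≠ 1) (hy : y ≠ 1)
    (hfarx : ∀ u v : H, u ≠ 0 → u ≠ 1 → v ≠ 0 → v ≠ 1 →
      Commute x u → Commute u v → Commute v (x⁻¹ * y) → False)
    (hfary : ∀ u v : H, u ≠ 0 → u ≠ 1 → v ≠ 0 → v ≠ 1 →
      Commute y u → Commute u v → Commute v (x⁻¹ * y) → False)
    {a b : D} (ha : π a = x) (hb : π b = y) :
    shiftSet π a ⊆ shiftSet π b ∨ shiftSet π b ⊆ shiftSet π a := by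
  by_contra! hcon
  have h1 := map_sub_eq_of_not_subset hneg hxy hx hfarx ha hb hcon.2
  have h2 : π (b - a) = y := by
    refine map_sub_eq_of_not_subset hneg (fun h => hxy h.symm) hy ?_ hb ha hcon.1
    intro u v hu hu1 hv hv1 c1 c2 c3
    refine hfary u v hu hu1 hv hv1 c1 c2 ?_
    have := c3.inv_right₀
    rwa [mul_inv_rev, inv_inv] at this
  rw [← neg_sub, map_neg_eq hneg, h1] at h2
  exact hxy (h2 ▸ Commute.refl _)

end ShiftSet

/-! ### Every element is a difference of two kernel elements -/

/-- In any coloring of the words over an alphabet with more letters than there are colors, where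
the colors are the coordinates themselves, two distinct words of the same color `i` differ only
in the coordinate `i`. -/
lemma exists_eq_off_color {ι : Type*} [Fintype ι] [Nonempty ι]
    (χ : (ι → Fin (Fintype.card ι + 1)) → ι) :
    ∃ f g, f ≠ g ∧ χ f = χ g ∧ ∀ i, i ≠ χ f → f i = g i := by
  classical
  have hk0 : 0 < Fintype.card ι := Fintype.card_pos
  -- Pigeonhole with k colors: recording the color and deleting that coordinate leaves only k (k +
  -- 1)^(k - 1) < (k + 1)^k values.
  let Φ : (ι → Fin (Fintype.card ι + 1)) →
      (Σ i : ι, ({j : ι // j ≠ i} → Fin (Fintype.card ι + 1))) := fun f => ⟨χ f, fun j => f j⟩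
  have hcard : Fintype.card (Σ i : ι, ({j : ι // j ≠ i} → Fin (Fintype.card ι + 1))) <
      Fintype.card (ι → Fin (Fintype.card ι + 1)) := by
    rw [Fintype.card_sigma]
    simp only [Fintype.card_fun, Fintype.card_fin, Fintype.card_subtype_compl,
      Fintype.card_subtype_eq, Finset.sum_const, Finset.card_univ, smul_eq_mul]
    obtain ⟨l, hl⟩ := Nat.exists_eq_succ_of_ne_zero hk0.ne'
    rw [hl, Nat.succ_sub_one, Nat.succ_eq_add_one, pow_succ (l + 1 + 1) l, mul_comm]
    exact Nat.mul_lt_mul_of_pos_left (by omega) (by positivity)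
  obtain ⟨f, g, hfg, h⟩ := Fintype.exists_ne_map_eq_of_card_lt Φ hcard
  have h1 : χ f = χ g := congrArg Sigma.fst h
  refine ⟨f, g, hfg, h1, fun i hi => ?_⟩
  have h2 : ∀ (p q : Σ i : ι, ({j : ι // j ≠ i} → Fin (Fintype.card ι + 1))), p = q →
      ∀ i (hp : i ≠ p.1) (hq : i ≠ q.1), p.2 ⟨i, hp⟩ = q.2 ⟨i, hq⟩ := by
    rintro p _ rfl i hp hq; rfl
  exact h2 _ _ h i hi (by rw [← h]; exact hi)

/-- A subgroup of finite index in the multiplicative group of a division ring that contains the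
nonzero elements of an infinite center is additively a difference set for the whole ring. -/
lemma exists_eq_sub_of_map_eq_one {D H : Type*} [DivisionRing D] [GroupWithZero H] [Finite H]
    (π : D →*₀ H) (hsurj : Function.Surjective π)
    (hcen : ∀ c ∈ Set.center D, c ≠ 0 → π c = 1) (hinf : (Set.center D).Infinite) (g : D) :
    ∃ n m, π n = 1 ∧ π m = 1 ∧ g = n - m := by
  classical
  cases nonempty_fintype H
  choose s hs using hsurj
  obtain ⟨e⟩ : Nonempty (Fin (Fintype.card H + 1) ↪ Set.center D) := by
    have := hinf.to_subtype
    exact ⟨(Fin.valEmbedding).trans (Infinite.natEmbedding _)⟩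
  -- A word chooses a central scalar for each coset representative, and its color is the coset of t
  -- + Q φ. Two words of color h that agree off h differ by s h * g * c with c central, so dividing
  -- by s h and c gives g.
  let Q : (H → Fin (Fintype.card H + 1)) → D := fun φ => ∑ h, s h * g * (e (φ h) : D)
  have : Infinite D := (Set.infinite_univ_iff.1 (hinf.mono (Set.subset_univ _)))
  obtain ⟨t, ht⟩ := Infinite.exists_notMem_finset (Finset.univ.image fun φ => -Q φ)
  have hne : ∀ φ, t + Q φ ≠ 0 := fun φ h =>
    ht (Finset.mem_image.2 ⟨φ, Finset.mem_univ _, (eq_neg_of_add_eq_zero_left h).symm⟩)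
  obtain ⟨φ, ψ, hφψ, hχ, hoff⟩ := exists_eq_off_color fun φ => π (t + Q φ)
  set h := π (t + Q φ) with hh
  have hh0 : h ≠ 0 := by rw [hh, Ne, map_eq_zero]; exact hne φ
  have hs0 : s h ≠ 0 := ne_zero_of_map_ne_zero (π := π) (by rwa [hs])
  have hneh : φ h ≠ ψ h := fun heq => hφψ (funext fun i => by
    by_cases hi : i = h
    · rw [hi, heq]
    · exact hoff i hi)
  have hdiff : (t + Q φ) - (t + Q ψ) = s h * g * ((e (φ h) : D) - e (ψ h)) := by
    rw [add_sub_add_left_eq_sub, ← Finset.sum_sub_distrib, Finset.sum_eq_single h]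
    · rw [mul_sub]
    · intro i _ hi
      rw [hoff i hi, sub_self]
    · intro hn; exact absurd (Finset.mem_univ _) hn
  set c : D := (e (φ h) : D) - e (ψ h) with hc
  have hcc : c ∈ Set.center D := (Subring.center D).sub_mem (e (φ h)).2 (e (ψ h)).2
  have hc0 : c ≠ 0 := sub_ne_zero.2 fun h' => hneh (e.injective (Subtype.ext h'))
  refine ⟨(s h)⁻¹ * (t + Q φ) * c⁻¹, (s h)⁻¹ * (t + Q ψ) * c⁻¹, ?_, ?_, ?_⟩
  · rw [map_mul, map_mul, map_inv₀, map_inv₀, hs, hcen c hcc hc0, ← hh]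
    simp [hh0]
  · rw [map_mul, map_mul, map_inv₀, map_inv₀, hs, hcen c hcc hc0, ← hχ]
    simp [hh0]
  · rw [← sub_mul, ← mul_sub, hdiff, mul_assoc (s h), inv_mul_cancel_left₀ hs0,
      mul_inv_cancel_right₀ hc0]

/-! ### Invariant preorders on the kernel -/

/-- The set of nonnegative elements of a two-sided invariant total preorder on the kernel
of `π`. -/
structure IsCone {D H : Type*} [DivisionRing D] [GroupWithZero H] (π : D →*₀ H) (V : Set D) :
    Prop where
  map_eq_one : ∀ n ∈ V, π n = 1
  one_mem : 1 ∈ V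
  mul_mem : ∀ m ∈ V, ∀ n ∈ V, m * n ∈ V
  conj_mem : ∀ m, π m = 1 → ∀ n ∈ V, m * n * m⁻¹ ∈ V
  total : ∀ n, π n = 1 → n ∈ V ∨ n⁻¹ ∈ V

namespace IsCone

variable {D H : Type*} [DivisionRing D] [GroupWithZero H] {π : D →*₀ H} {V : Set D}

lemma neg_one_mem (hV : IsCone π V) (hneg : π (-1) = 1) : -1 ∈ V := by
  have := hV.total _ hneg
  rwa [inv_neg_one, or_self] at this

lemma neg_mem (hV : IsCone π V) (hneg : π (-1) = 1) {n : D} (hn : n ∈ V) : -n ∈ V := by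
  rw [← neg_one_mul]; exact hV.mul_mem _ (hV.neg_one_mem hneg) _ hn

lemma mul_mem_comm (hV : IsCone π V) {m n : D} (hm : π m = 1) (h : m * n ∈ V) :
    n * m ∈ V := by
  have := hV.conj_mem m⁻¹ (map_inv_eq_one hm) _ h
  rwa [inv_inv, inv_mul_cancel_left₀ (ne_zero_of_map_eq_one hm)] at this

/-- With q ≤ r read as q⁻¹ * r ∈ V, an element p outside V is negative, so r * p⁻¹ lies strictly
above r, the larger of the two. -/
lemma exists_gt (hV : IsCone π V) (hp : ∃ p, π p = 1 ∧ p ∉ V) {q r : D} (hq : π q = 1)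
    (hr : π r = 1) : ∃ k, π k = 1 ∧ k⁻¹ * q ∉ V ∧ k⁻¹ * r ∉ V := by
  obtain ⟨p, hp1, hp⟩ := hp
  have key : ∀ q r : D, π q = 1 → π r = 1 → q⁻¹ * r ∈ V →
      ∃ k, π k = 1 ∧ k⁻¹ * q ∉ V ∧ k⁻¹ * r ∉ V := by
    intro q r hq hr h
    have hp0 := ne_zero_of_map_eq_one hp1
    have hr0 := ne_zero_of_map_eq_one hr
    have hq0 := ne_zero_of_map_eq_one hq
    refine ⟨r * p⁻¹, by simp [hr, hp1], fun h1 => hp ?_, fun h1 => hp ?_⟩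
    · have := hV.mul_mem _ h1 _ h
      rwa [mul_inv_rev, inv_inv, mul_assoc, mul_inv_cancel_left₀ hq0,
        inv_mul_cancel_right₀ hr0] at this
    · rwa [mul_inv_rev, inv_inv, inv_mul_cancel_right₀ hr0] at h1
  rcases hV.total (q⁻¹ * r) (by simp [hq, hr]) with h | h
  · exact key q r hq hr h
  · rw [mul_inv_rev, inv_inv] at h
    obtain ⟨k, hk, h1, h2⟩ := key r q hr hq h
    exact ⟨k, hk, h2, h1⟩

end IsCone

/-! ### Incident pairs and their cone -/

/-- A pair of values of `π` that no nontrivial element centralizes simultaneously, and whose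
representatives have comparable shift sets. -/
structure IsIncidentPair {D H : Type*} [DivisionRing D] [GroupWithZero H] (π : D →*₀ H)
    (x y : H) : Prop where
  left_ne_zero : x ≠ 0
  right_ne_zero : y ≠ 0
  right_ne_one : y ≠ 1
  far : ∀ z, z ≠ 0 → Commute x z → Commute z y → z = 1
  incident : ∀ a b, π a = x → π b = y →
    shiftSet π a ⊆ shiftSet π b ∨ shiftSet π b ⊆ shiftSet π a

section Incident

variable {D H : Type*} [DivisionRing D] [GroupWithZero H] {π : D →*₀ H} {x y : H}

lemma shiftSet_nonempty (hsub : ∀ g, ∃ n m, π n = 1 ∧ π m = 1 ∧ g = n - m) (a : D) :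
    (shiftSet π a).Nonempty := by
  obtain ⟨n, m, hn, hm, rfl⟩ := hsub a
  exact ⟨m, hm, by rwa [sub_add_cancel]⟩

lemma exists_one_mem_shiftSet (hsub : ∀ g, ∃ n m, π n = 1 ∧ π m = 1 ∧ g = n - m)
    (a : D) : ∃ j, π j = 1 ∧ 1 ∈ shiftSet π (j * a) := by
  obtain ⟨n, hn⟩ := shiftSet_nonempty hsub a
  exact ⟨n⁻¹, map_inv_eq_one hn.1, (one_mem_shiftSet_inv_mul hn.1).2 hn⟩

/-- Otherwise a + 1 is in the kernel for every representative a of x. Writing -a⁻¹ = n - m gives na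
+ (1 - ma) = 0, yet 1 - ma and then na + (1 - ma) would be in the kernel. -/
lemma exists_one_notMem_shiftSet (hneg : π (-1) = 1)
    (hsub : ∀ g, ∃ n m, π n = 1 ∧ π m = 1 ∧ g = n - m)
    (hx0 : x ≠ 0) (hsurj : Function.Surjective π) :
    ∃ a, π a = x ∧ 1 ∉ shiftSet π a := by
  by_contra! hcon
  obtain ⟨a, ha⟩ := hsurj x
  have ha0 : a ≠ 0 := ne_zero_of_map_ne_zero (ha ▸ hx0)
  obtain ⟨n, m, hn, hm, h⟩ := hsub ((-1) * a⁻¹)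
  have h1 : n * a + (1 + -m * a) = 0 := by
    have : (n - m) * a = -1 := by rw [← h, inv_mul_cancel_right₀ ha0]
    rw [sub_mul] at this
    rw [neg_mul, add_left_comm, ← sub_eq_add_neg, this, add_neg_cancel]
  have h2 : π (1 + -m * a) = 1 := by
    rw [add_comm]
    exact (hcon (-m * a) (by rw [map_mul, map_neg_eq hneg, hm, ha, one_mul])).2
  have h3 : 1 + -m * a ∈ shiftSet π (n * a) := by
    rw [← one_mem_shiftSet_inv_mul h2]
    exact hcon _ (by
      rw [map_mul, map_mul, map_inv₀, h2, hn, ha, inv_one, one_mul, one_mul])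
  have := h3.2
  rw [h1, map_zero] at this
  exact zero_ne_one this

/-- The image of the sum commutes with x, because m + c is added to a, and with y, because a + m is
added to c; only 1 does both. -/
lemma IsIncidentPair.map_add_add (h : IsIncidentPair π x y) (hneg : π (-1) = 1) {a c m : D}
    (ha : π a = x) (hc : π c = y) (h1 : π (a + m) = 1) (h2 : π (m + c) = 1) :
    π (a + m + c) = 1 := by
  refine h.far _ ?_ ?_ ?_
  · rw [Ne, map_eq_zero]
    intro h0
    have : c = -(a + m) := eq_neg_of_add_eq_zero_right h0
    rw [this, map_neg_eq hneg, h1] at hc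
    exact h.right_ne_one hc.symm
  · rw [add_assoc, ← ha]; exact (commute_map_add h2 a).symm
  · rw [add_comm, ← hc]; exact commute_map_add h1 c

variable (π x y) in
/-- The cone of the preorder on the kernel of `π` by its action on the inclusions between shift
sets of representatives of `x` and of `y`. -/
def incidenceCone : Set D :=
  {n | π n = 1 ∧ ∀ a b, π a = x → π b = y → shiftSet π a ⊆ shiftSet π b →
    shiftSet π a ⊆ shiftSet π (n * b)}

lemma IsIncidentPair.isCone (h : IsIncidentPair π x y) : IsCone π (incidenceCone π x y) where
  map_eq_one n hn := hn.1
  one_mem := ⟨map_one π, fun a b _ _ hab => by rwa [one_mul]⟩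
  mul_mem m hm n hn := ⟨by rw [map_mul, hm.1, hn.1, one_mul], fun a b ha hb hab => by
    rw [mul_assoc]
    exact hm.2 a _ ha (by rw [map_mul, hn.1, hb, one_mul]) (hn.2 a b ha hb hab)⟩
  conj_mem m hm n hn := by
    have hm0 := ne_zero_of_map_eq_one hm
    refine ⟨by simp [hm, hn.1], fun a b ha hb hab => ?_⟩
    have h1 := shiftSet_mul_left_subset (map_inv_eq_one hm) hab
    have h2 := hn.2 _ _ (by simp [hm, ha]) (by simp [hm, hb]) h1
    have h3 := shiftSet_mul_left_subset hm h2
    rwa [mul_inv_cancel_left₀ hm0, ← mul_assoc, ← mul_assoc] at h3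
  total n hn := by
    by_contra! hcon
    have hn0 := ne_zero_of_map_eq_one hn
    have hni := map_inv_eq_one hn
    simp only [incidenceCone, Set.mem_ofPred_eq, hn, hni, true_and, not_forall] at hcon
    obtain ⟨⟨a, b, ha, hb, hab, h1⟩, ⟨a', b', ha', hb', hab', h2⟩⟩ := hcon
    have hb0 : b ≠ 0 := ne_zero_of_map_ne_zero (hb ▸ h.right_ne_zero)
    have hb0' : b' ≠ 0 := ne_zero_of_map_ne_zero (hb' ▸ h.right_ne_zero)
    -- Right translation by m = b'⁻¹b moves the second witness over b. The chain S(a) ⊆ S(b) ⊆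
    -- S(na'm) ⊆ S(nb) then contradicts the choice of a and b.
    have hm : π (b'⁻¹ * b) = 1 := by
      rw [map_mul, map_inv₀, hb, hb', inv_mul_cancel₀ h.right_ne_zero]
    have h3 : shiftSet π (n * b) ⊆ shiftSet π a :=
      (h.incident a _ ha (by simp [hn, hb])).resolve_left h1
    have h4 : shiftSet π (n⁻¹ * b') ⊆ shiftSet π a' :=
      (h.incident a' _ ha' (by simp [hn, hb'])).resolve_left h2
    have h5 := shiftSet_mul_left_subset hn (shiftSet_mul_right_subset hm h4)
    rw [mul_assoc n⁻¹, mul_inv_cancel_left₀ hn0, mul_inv_cancel_left₀ hb0'] at h5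
    have h6 := shiftSet_mul_left_subset hn (shiftSet_mul_right_subset hm hab')
    rw [mul_inv_cancel_left₀ hb0'] at h6
    exact h1 ((hab.trans h5).trans h6)

/-- Multiplication by a positive element of the kernel enlarges all shift sets of representatives
of `x` and `y`. -/
lemma IsIncidentPair.subset_of_inv_notMem (h : IsIncidentPair π x y) {n : D} (hn : π n = 1)
    (hpos : n⁻¹ ∉ incidenceCone π x y) :
    (∀ a, π a = x → shiftSet π a ⊆ shiftSet π (n * a)) ∧
    (∀ b, π b = y → shiftSet π b ⊆ shiftSet π (n * b)) := by
  have hn0 := ne_zero_of_map_eq_one hn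
  have hni := map_inv_eq_one hn
  simp only [incidenceCone, Set.mem_ofPred_eq, hni, true_and, not_forall] at hpos
  obtain ⟨a, b, ha, hb, hab, h1⟩ := hpos
  have ha0 : a ≠ 0 := ne_zero_of_map_ne_zero (ha ▸ h.left_ne_zero)
  have hb0 : b ≠ 0 := ne_zero_of_map_ne_zero (hb ▸ h.right_ne_zero)
  -- This and S(a) ⊆ S(b) give S(a) ⊆ S(b) ⊆ S(na) ⊆ S(nb) after translation by n. Other
  -- representatives differ from a and b by right factors in the kernel.
  have h2 : shiftSet π (n⁻¹ * b) ⊆ shiftSet π a :=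
    (h.incident a _ ha (by simp [hn, hb])).resolve_left h1
  have h3 := shiftSet_mul_left_subset hn h2
  rw [mul_inv_cancel_left₀ hn0] at h3
  have h4 := shiftSet_mul_left_subset hn hab
  constructor
  · intro a' ha'
    have := shiftSet_mul_right_subset (m := a⁻¹ * a') (π := π)
      (by rw [map_mul, map_inv₀, ha, ha', inv_mul_cancel₀ h.left_ne_zero]) (hab.trans h3)
    rwa [mul_inv_cancel_left₀ ha0, mul_assoc, mul_inv_cancel_left₀ ha0] at this
  · intro b' hb'
    have := shiftSet_mul_right_subset (m := b⁻¹ * b') (π := π)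
      (by rw [map_mul, map_inv₀, hb, hb', inv_mul_cancel₀ h.right_ne_zero]) (h3.trans h4)
    rwa [mul_inv_cancel_left₀ hb0, mul_assoc, mul_inv_cancel_left₀ hb0] at this

/-- If the cone were the whole kernel, a single n would lie in every S over x or in every S over y,
and translating by n⁻¹ contradicts `exists_one_notMem_shiftSet`. -/
lemma IsIncidentPair.exists_notMem_cone (h : IsIncidentPair π x y) (hneg : π (-1) = 1)
    (hsub : ∀ g, ∃ n m, π n = 1 ∧ π m = 1 ∧ g = n - m) (hsurj : Function.Surjective π) :
    ∃ p, π p = 1 ∧ p ∉ incidenceCone π x y := by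
  have key : ∀ (z : H), z ≠ 0 → ∀ n, π n = 1 → (∀ a, π a = z → n ∈ shiftSet π a) → False := by
    intro z hz n hn hall
    obtain ⟨a, ha, h1⟩ := exists_one_notMem_shiftSet hneg hsub hz hsurj
    apply h1
    have := (one_mem_shiftSet_inv_mul hn).2 (hall (n * a) (by simp [hn, ha]))
    rwa [inv_mul_cancel_left₀ (ne_zero_of_map_eq_one hn)] at this
  by_contra! hall
  obtain ⟨b, hb⟩ := hsurj y
  have hb0 : b ≠ 0 := ne_zero_of_map_ne_zero (hb ▸ h.right_ne_zero)
  obtain ⟨n, hn⟩ := shiftSet_nonempty hsub b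
  by_cases hex : ∃ a, π a = x ∧ shiftSet π a ⊆ shiftSet π b
  · obtain ⟨a, ha, hab⟩ := hex
    obtain ⟨n, hn⟩ := shiftSet_nonempty hsub a
    refine key y h.right_ne_zero n hn.1 fun b' hb' => ?_
    have := (hall (b' * b⁻¹) (by
      rw [map_mul, map_inv₀, hb, hb', mul_inv_cancel₀ h.right_ne_zero])).2 a b ha hb hab
    rw [inv_mul_cancel_right₀ hb0] at this
    exact this hn
  · push Not at hex
    exact key x h.left_ne_zero n hn.1 fun a ha =>
      (h.incident a b ha hb).resolve_left (hex a ha) hn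

/-- The ring generated by the cone of an incident pair has a multiple `k * R` by a kernel element
with `1 + k * R` in the kernel. -/
theorem IsIncidentPair.exists_map_one_add_mul (h : IsIncidentPair π x y) (hneg : π (-1) = 1)
    (hsub : ∀ g, ∃ n m, π n = 1 ∧ π m = 1 ∧ g = n - m) (hsurj : Function.Surjective π) :
    ∃ k, π k = 1 ∧ ∀ r ∈ Subring.closure (incidenceCone π x y), π (1 + k * r) = 1 := by
  have hV := h.isCone
  have hpV := h.exists_notMem_cone hneg hsub hsurj
  obtain ⟨a₀, ha₀⟩ := hsurj x
  obtain ⟨b, hb⟩ := hsurj y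
  have hb0 : b ≠ 0 := ne_zero_of_map_ne_zero (hb ▸ h.right_ne_zero)
  obtain ⟨i, hi, hia⟩ := exists_one_mem_shiftSet hsub a₀
  obtain ⟨a₂, ha₂, ha₂'⟩ := exists_one_notMem_shiftSet hneg hsub h.left_ne_zero hsurj
  obtain ⟨j, hj, hjb⟩ := exists_one_mem_shiftSet hsub b
  have ha₁ : π (i * a₀) = x := by simp [hi, ha₀]
  generalize i * a₀ = a₁ at hia ha₁
  have ha10 : a₁ ≠ 0 := ne_zero_of_map_ne_zero (ha₁ ▸ h.left_ne_zero)
  have hκ : π (a₂ * a₁⁻¹) = 1 := by simp [ha₁, ha₂, h.left_ne_zero]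
  set κ := a₂ * a₁⁻¹ with hκdef
  have hκa : κ * a₁ = a₂ := inv_mul_cancel_right₀ ha10 _
  -- T collects the m that can replace 1 in a + 1 for all relevant a at once. The aim is a large
  -- additive stabilizer of T.
  let T : Set D := {m | π m = 1 ∧ ∀ a, π a = x → 1 ∈ shiftSet π a → π (a + m) = 1}
  have hT1 : (1 : D) ∈ T := ⟨map_one π, fun a _ h1 => h1.2⟩
  -- T is bounded above by κ⁻¹: a larger m would make κm positive and carry 1 ∈ S(m⁻¹a₁) into S(a₂),
  -- where 1 is missing.
  have hUB : ∀ m ∈ T, m⁻¹ * κ⁻¹ ∈ incidenceCone π x y := by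
    intro m hm
    have hm0 := ne_zero_of_map_eq_one hm.1
    by_contra hcon
    have h1 := (h.subset_of_inv_notMem (n := κ * m) (by simp [hκ, hm.1])
      (by rwa [mul_inv_rev])).1 (m⁻¹ * a₁) (by simp [hm.1, ha₁])
    rw [mul_assoc, mul_inv_cancel_left₀ hm0, hκa] at h1
    exact ha₂' (h1 ((one_mem_shiftSet_inv_mul hm.1).2 ⟨hm.1, hm.2 _ ha₁ hia⟩))
  have hj0 := ne_zero_of_map_eq_one hj
  -- For n above κ⁻¹j, m⁻¹nj⁻¹ is positive for all m in T, so 1 ∈ S(jb) passes to S(m⁻¹nb). Hence m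
  -- + nb is in the kernel, and `map_add_add` yields T + nb ⊆ T.
  have hstep : ∀ n, π n = 1 → n⁻¹ * (κ⁻¹ * j) ∉ incidenceCone π x y →
      ∀ m ∈ T, m + n * b ∈ T := by
    intro n hn hpos m hm
    have hm0 := ne_zero_of_map_eq_one hm.1
    have h1 : j * n⁻¹ * m ∉ incidenceCone π x y := by
      intro hc
      apply hpos
      have h2 := hV.mul_mem _ hc _ (hUB m hm)
      rw [mul_assoc (j * n⁻¹), mul_inv_cancel_left₀ hm0, mul_assoc] at h2
      have h3 := hV.mul_mem_comm hj h2
      rwa [mul_assoc] at h3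
    have h2 := (h.subset_of_inv_notMem (n := m⁻¹ * n * j⁻¹) (by simp [hm.1, hn, hj])
      (by rwa [mul_inv_rev, mul_inv_rev, inv_inv, inv_inv, ← mul_assoc])).2 (j * b)
      (by simp [hj, hb]) hjb
    rw [mul_assoc, inv_mul_cancel_left₀ hj0, mul_assoc, one_mem_shiftSet_inv_mul hm.1] at h2
    have h3 : π (m + n * b) = 1 := by rw [add_comm]; exact h2.2
    refine ⟨h3, fun a ha h1a => ?_⟩
    rw [← add_assoc]
    exact h.map_add_add hneg ha (by simp [hn, hb]) (hm.2 a ha h1a) h3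
  let St : AddSubmonoid D :=
    { carrier := {t | ∀ m ∈ T, m + t ∈ T}
      zero_mem' := fun m hm => by rwa [add_zero]
      add_mem' := fun {s t} hs ht m hm => by rw [← add_assoc]; exact ht _ (hs m hm) }
  -- Only multiples of b are known to stabilize T. Splitting 1 as n₁b - n₂b makes kv a sum of two of
  -- them, and k is chosen large enough for both.
  obtain ⟨n₁, n₂, hn₁, hn₂, hbn⟩ := hsub b⁻¹
  have hone : (1 : D) = n₁ * b + -n₂ * b := by
    rw [← add_mul, ← sub_eq_add_neg, ← hbn, inv_mul_cancel₀ hb0]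
  have hn₂' : π (-n₂) = 1 := by rw [map_neg_eq hneg, hn₂]
  generalize -n₂ = n₂' at hone hn₂'
  have hκj : π (κ⁻¹ * j) = 1 := by simp [hκ, hj]
  set q := κ⁻¹ * j
  clear_value q
  obtain ⟨k, hk, hk1, hk2⟩ := hV.exists_gt hpV (q := q * n₁⁻¹) (r := q * n₂'⁻¹)
    (by simp [hκj, hn₁]) (by simp [hκj, hn₂'])
  have hmem : ∀ v ∈ incidenceCone π x y, ∀ n, π n = 1 →
      k⁻¹ * (q * n⁻¹) ∉ incidenceCone π x y → k * v * (n * b) ∈ St := by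
    intro v hv n hn hkn m hm
    have hv1 := hV.map_eq_one v hv
    have hv0 := ne_zero_of_map_eq_one hv1
    rw [← mul_assoc]
    refine hstep (k * v * n) (by simp [hk, hn, hv1]) (fun hc => hkn ?_) m hm
    rw [mul_inv_rev, mul_inv_rev, mul_assoc] at hc
    have h1 := hV.mul_mem_comm (map_inv_eq_one hn) hc
    rw [mul_assoc, mul_assoc] at h1
    have h2 := hV.mul_mem _ hv _ h1
    rwa [mul_inv_cancel_left₀ hv0] at h2
  have hkv : ∀ v ∈ incidenceCone π x y, k * v ∈ St := by
    intro v hv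
    rw [← mul_one (k * v), hone, mul_add]
    exact St.add_mem (hmem v hv n₁ hn₁ hk1) (hmem v hv n₂' hn₂' hk2)
  refine ⟨k, hk, fun r hr => ?_⟩
  have hkr : k * r ∈ St ∧ k * -r ∈ St := by
    rw [Subring.mem_closure_iff] at hr
    let M : Submonoid D :=
      { carrier := incidenceCone π x y
        one_mem' := hV.one_mem
        mul_mem' := fun {s t} hs ht => hV.mul_mem s hs t ht }
    have hM : Submonoid.closure (incidenceCone π x y) = M := Submonoid.closure_eq M
    rw [hM] at hr
    induction hr using AddSubgroup.closure_induction with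
    | mem v hv => exact ⟨hkv v hv, hkv _ (hV.neg_mem hneg hv)⟩
    | zero => simp
    | add s t _ _ hs ht =>
      rw [neg_add, mul_add, mul_add]
      exact ⟨St.add_mem hs.1 ht.1, St.add_mem hs.2 ht.2⟩
    | neg s _ hs => rw [neg_neg]; exact hs.symm
  exact (hkr.1 1 hT1).1

end Incident

/-! ### Cofinality of central elements and kernel subrings -/

section Center

variable {D : Type*} [DivisionRing D]

lemma inv_mem_center {c : D} (hc : c ∈ Set.center D) : c⁻¹ ∈ Set.center D :=
  Set.inv_mem_center hc

lemma commute_of_mem_center {c : D} (hc : c ∈ Set.center D) (a : D) : c * a = a * c :=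
  hc.comm a

end Center

/-- A subring that contains, up to inversion, the kernel of `π`, is normalized by it, becomes the
whole ring after inverting central elements, and has a central multiple close to zero. -/
structure IsKernelSubring {D H : Type*} [DivisionRing D] [GroupWithZero H] (π : D →*₀ H)
    (R : Subring D) : Prop where
  total : ∀ n, π n = 1 → n ∈ R ∨ n⁻¹ ∈ R
  conj_mem : ∀ m, π m = 1 → ∀ r ∈ R, m * r * m⁻¹ ∈ R
  exists_map_one_add : ∃ e ∈ Set.center D, e ≠ 0 ∧ ∀ r ∈ R, π (1 + e * r) = 1
  exists_mul_mem : ∀ t, ∃ f ∈ Set.center D, f ≠ 0 ∧ f * t ∈ R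

section Cofinal

variable {D H : Type*} [DivisionRing D] [GroupWithZero H] {π : D →*₀ H} {V : Set D}

lemma IsCone.pow_mem (hV : IsCone π V) {p : D} (hp : p ∈ V) (j : ℕ) : p ^ j ∈ V := by
  induction j with
  | zero => rw [pow_zero]; exact hV.one_mem
  | succ j ih => rw [pow_succ]; exact hV.mul_mem _ ih _ hp

/-- If all nonzero central elements lay below k, then fk would be in V for each of them. A
dependence among powers of k², divided by its lowest term, would then read 1 + kr = 0 with r in the
ring. -/
lemma IsCone.exists_central_ge (hV : IsCone π V) (hcen : ∀ c ∈ Set.center D, c ≠ 0 → π c = 1)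
    (hbd : BoundedOverCenter D) {k : D} (hk : π k = 1)
    (h1 : ∀ r ∈ Subring.closure V, π (1 + k * r) = 1) :
    ∃ f ∈ Set.center D, f ≠ 0 ∧ k⁻¹ * f ∈ V := by
  by_contra! hcon
  have hk0 := ne_zero_of_map_eq_one hk
  have hfk : ∀ f ∈ Set.center D, f ≠ 0 → f * k ∈ V := by
    intro f hf hf0
    have := (hV.total (k⁻¹ * f⁻¹) (by simp [hk, hcen f hf hf0])).resolve_left
      (hcon f⁻¹ (inv_mem_center hf) (inv_ne_zero hf0))
    rwa [mul_inv_rev, inv_inv, inv_inv] at this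
  have hkV : k ∈ V := by simpa using hfk 1 (Set.one_mem_center) one_ne_zero
  -- One factor k is pulled out in front of r; the other absorbs an arbitrary central coefficient.
  set p := k * k with hp
  have hpV : p ∈ V := hV.mul_mem _ hkV _ hkV
  have hp0 : p ≠ 0 := mul_ne_zero hk0 hk0
  obtain ⟨d, hd⟩ := hbd
  obtain ⟨c, hc, hc0, hsum⟩ := hd fun i => p ^ (i : ℕ)
  obtain ⟨i₁, hi₁⟩ : ∃ i, c i ≠ 0 := by
    by_contra! h; exact hc0 (funext h)
  classical
  obtain ⟨i₀, hi₀, hmin⟩ := Finset.exists_min_image (Finset.univ.filter (c · ≠ 0)) id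
    ⟨i₁, by simpa using hi₁⟩
  have hi₀' : c i₀ ≠ 0 := by simpa using hi₀
  have hr : ∀ i, ∃ r ∈ Subring.closure V,
      i ≠ i₀ → (c i₀)⁻¹ * (c i * p ^ (i : ℕ)) * (p ^ (i₀ : ℕ))⁻¹ = k * r := by
    intro i
    by_cases hci : c i = 0
    · exact ⟨0, Subring.zero_mem _, fun _ => by simp [hci]⟩
    by_cases hii : i = i₀
    · exact ⟨0, Subring.zero_mem _, fun h => absurd hii h⟩
    have hle : i₀ ≤ i := hmin i (by simpa using hci)
    obtain ⟨j, hj⟩ : ∃ j, (i : ℕ) = (j + 1) + i₀ := by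
      have : i₀ < i := lt_of_le_of_ne hle (Ne.symm hii)
      exact ⟨i - i₀ - 1, by omega⟩
    have hc' : (c i₀)⁻¹ * c i ∈ Set.center D :=
      Set.mul_mem_center (inv_mem_center (hc i₀)) (hc i)
    refine ⟨(c i₀)⁻¹ * c i * k * p ^ j, Subring.subset_closure (hV.mul_mem _
      (hfk _ hc' (mul_ne_zero (inv_ne_zero hi₀') hci)) _ (hV.pow_mem hpV j)), fun _ => ?_⟩
    rw [hj, pow_add, ← mul_assoc (c i), mul_assoc, mul_assoc (c i * _),
      mul_inv_cancel₀ (pow_ne_zero _ hp0), mul_one, pow_succ', hp, ← mul_assoc (c i₀)⁻¹,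
      ← mul_assoc k, ← mul_assoc k, ← commute_of_mem_center hc' k]
    simp only [mul_assoc]
  choose r hrR hr using hr
  have h0 : 1 + k * ∑ i ∈ Finset.univ.erase i₀, r i = 0 := by
    have h2 : (c i₀)⁻¹ * (∑ i, c i * p ^ (i : ℕ)) * (p ^ (i₀ : ℕ))⁻¹ = 0 := by
      rw [hsum, mul_zero, zero_mul]
    rw [Finset.mul_sum, Finset.sum_mul, ← Finset.add_sum_erase _ _ (Finset.mem_univ i₀),
      inv_mul_cancel_left₀ hi₀', mul_inv_cancel₀ (pow_ne_zero _ hp0)] at h2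
    rw [← h2, Finset.mul_sum]
    congr 1
    exact Finset.sum_congr rfl fun i hi => (hr i (Finset.ne_of_mem_erase hi)).symm
  have := h1 _ (Subring.sum_mem _ fun i (_ : i ∈ Finset.univ.erase i₀) => hrR i)
  rw [h0, map_zero] at this
  exact zero_ne_one this

lemma IsCone.isKernelSubring (hV : IsCone π V) (hcen : ∀ c ∈ Set.center D, c ≠ 0 → π c = 1)
    (hbd : BoundedOverCenter D)
    (hsub : ∀ g, ∃ n m, π n = 1 ∧ π m = 1 ∧ g = n - m) {k : D} (hk : π k = 1)
    (h1 : ∀ r ∈ Subring.closure V, π (1 + k * r) = 1) :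
    IsKernelSubring π (Subring.closure V) := by
  have hk0 := ne_zero_of_map_eq_one hk
  -- Above k, q inherits 1 + qR ⊆ N from k because k⁻¹q is in R; below k, a central bound for k also
  -- bounds q.
  have hcof : ∀ q, π q = 1 → ∃ f ∈ Set.center D, f ≠ 0 ∧ q⁻¹ * f ∈ V := by
    intro q hq
    have hq0 := ne_zero_of_map_eq_one hq
    rcases hV.total (k⁻¹ * q) (by simp [hk, hq]) with h | h
    · refine hV.exists_central_ge hcen hbd hq fun r hr => ?_
      have := h1 (k⁻¹ * q * r) (Subring.mul_mem _ (Subring.subset_closure h) hr)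
      rwa [← mul_assoc, mul_inv_cancel_left₀ hk0] at this
    · obtain ⟨f, hf, hf0, hfV⟩ := hV.exists_central_ge hcen hbd hk h1
      refine ⟨f, hf, hf0, ?_⟩
      have := hV.mul_mem _ h _ hfV
      rwa [mul_inv_rev, inv_inv, mul_assoc, mul_inv_cancel_left₀ hk0] at this
  refine ⟨fun n hn => ?_, fun m hm r hr => ?_, ?_, fun t => ?_⟩
  · exact (hV.total n hn).imp (fun h => Subring.subset_closure h)
      fun h => Subring.subset_closure h
  · have hm0 := ne_zero_of_map_eq_one hm
    induction hr using Subring.closure_induction with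
    | mem v hv => exact Subring.subset_closure (hV.conj_mem m hm v hv)
    | zero => simp
    | one => simp [hm0]
    | add s t _ _ hs ht => rw [mul_add, add_mul]; exact Subring.add_mem _ hs ht
    | neg s _ hs => rw [mul_neg, neg_mul]; exact Subring.neg_mem _ hs
    | mul s t _ _ hs ht =>
      have := Subring.mul_mem _ hs ht
      rwa [mul_assoc (m * s), mul_assoc m t, inv_mul_cancel_left₀ hm0, ← mul_assoc,
        mul_assoc m s] at this
  · obtain ⟨f, hf, hf0, hfV⟩ := hcof k hk
    refine ⟨f, hf, hf0, fun r hr => ?_⟩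
    have := h1 _ (Subring.mul_mem _ (Subring.subset_closure hfV) hr)
    rwa [← mul_assoc, mul_inv_cancel_left₀ hk0] at this
  · obtain ⟨n, m, hn, hm, rfl⟩ := hsub t
    have key : ∀ n m, π n = 1 → π m = 1 → n * m⁻¹ ∈ V →
        ∃ f ∈ Set.center D, f ≠ 0 ∧ f * n ∈ V ∧ f * m ∈ V := by
      intro n m hn hm h
      have hm0 := ne_zero_of_map_eq_one hm
      obtain ⟨f, hf, hf0, hfV⟩ := hcof m⁻¹ (map_inv_eq_one hm)
      rw [inv_inv] at hfV
      refine ⟨f, hf, hf0, ?_, by rwa [commute_of_mem_center hf]⟩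
      have := hV.mul_mem _ h _ hfV
      rwa [mul_assoc, inv_mul_cancel_left₀ hm0, ← commute_of_mem_center hf] at this
    have : ∃ f ∈ Set.center D, f ≠ 0 ∧ f * n ∈ V ∧ f * m ∈ V := by
      rcases hV.total (n * m⁻¹) (by simp [hn, hm]) with h | h
      · exact key n m hn hm h
      · rw [mul_inv_rev, inv_inv] at h
        obtain ⟨f, hf, hf0, h1, h2⟩ := key m n hm hn h
        exact ⟨f, hf, hf0, h2, h1⟩
    obtain ⟨f, hf, hf0, h1, h2⟩ := this
    refine ⟨f, hf, hf0, ?_⟩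
    rw [mul_sub]
    exact Subring.sub_mem _ (Subring.subset_closure h1) (Subring.subset_closure h2)

end Cofinal

/-- A subring that contains every element or its inverse, is invariant under conjugation, and
whose nonunits `t` satisfy `π (1 + t) = 1`. -/
structure IsInvariantValuationRing {D H : Type*} [DivisionRing D] [GroupWithZero H]
    (π : D →*₀ H) (O : Subring D) : Prop where
  total : ∀ t, t ∈ O ∨ t⁻¹ ∈ O
  conj_mem : ∀ g, g ≠ 0 → ∀ r ∈ O, g * r * g⁻¹ ∈ O
  map_one_add : ∀ t ∈ O, t⁻¹ ∉ O → π (1 + t) = 1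

/-- A central element `e` of a subring `R` such that `1 + e * R` lies in the kernel of `π`, and
`R` is a conjugation invariant valuation ring up to factors of `e`. -/
structure IsScale {D H : Type*} [DivisionRing D] [GroupWithZero H] (π : D →*₀ H)
    (R : Subring D) (e : D) : Prop where
  mem_center : e ∈ Set.center D
  ne_zero : e ≠ 0
  mem : e ∈ R
  map_one_add : ∀ r ∈ R, π (1 + e * r) = 1
  conj_mem : ∀ g, g ≠ 0 → ∀ r ∈ R, e ^ 2 * (g * r * g⁻¹) ∈ R
  total : ∀ g, g ≠ 0 → e * g ∈ R ∨ e * g⁻¹ ∈ R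

/-! ### Scales and the rings obtained by inverting them -/

section Scale

variable {D H : Type*} [DivisionRing D] [GroupWithZero H] {π : D →*₀ H} {R : Subring D}

lemma IsKernelSubring.exists_mul_mem_finset (hR : IsKernelSubring π R)
    (hcen : ∀ c ∈ Set.center D, c ≠ 0 → π c = 1) (s : Finset D) :
    ∃ f ∈ Set.center D, f ≠ 0 ∧ f ∈ R ∧ ∀ t ∈ s, f * t ∈ R := by
  classical
  induction s using Finset.induction_on with
  | empty => exact ⟨1, Set.one_mem_center, one_ne_zero, R.one_mem, by simp⟩
  | insert t s _ ih =>
    obtain ⟨f, hf, hf0, hfR, hfs⟩ := ih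
    obtain ⟨g, hg, hg0, hgt⟩ := hR.exists_mul_mem t
    rcases hR.total g (hcen g hg hg0) with h | h
    · refine ⟨f * g, Set.mul_mem_center hf hg, mul_ne_zero hf0 hg0, R.mul_mem hfR h, ?_⟩
      intro u hu
      rcases Finset.mem_insert.1 hu with rfl | hu
      · rw [mul_assoc]; exact R.mul_mem hfR hgt
      · rw [commute_of_mem_center hf, mul_assoc]; exact R.mul_mem h (hfs u hu)
    · refine ⟨f, hf, hf0, hfR, fun u hu => ?_⟩
      rcases Finset.mem_insert.1 hu with rfl | hu
      · have := R.mul_mem h hgt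
        rw [inv_mul_cancel_left₀ hg0] at this
        exact R.mul_mem hfR this
      · exact hfs u hu

/-- By finite index, one central multiplier f brings all coset representatives and their inverses
into R; multiplying it by the element c with 1 + cR ⊆ N gives the scale. Conjugation costs e²
because both s h and its inverse need a factor. -/
lemma IsKernelSubring.exists_isScale [Finite H] (hR : IsKernelSubring π R)
    (hcen : ∀ c ∈ Set.center D, c ≠ 0 → π c = 1) (hsurj : Function.Surjective π) :
    ∃ e, IsScale π R e := by
  classical
  cases nonempty_fintype H
  choose s hs using hsurj
  obtain ⟨c, hc, hc0, hcR⟩ := hR.exists_map_one_add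
  have hcmem : c ∈ R := (hR.total c (hcen c hc hc0)).resolve_right fun h => by
    have := hcR _ (R.neg_mem h)
    rw [mul_neg, mul_inv_cancel₀ hc0, add_neg_cancel, map_zero] at this
    exact zero_ne_one this
  obtain ⟨f, hf, hf0, hfR, hft⟩ := hR.exists_mul_mem_finset hcen
    (Finset.univ.image s ∪ Finset.univ.image fun h => (s h)⁻¹)
  have hfs : ∀ h, c * f * s h ∈ R := fun h => by
    rw [mul_assoc]
    exact R.mul_mem hcmem (hft _ (Finset.mem_union_left _
      (Finset.mem_image_of_mem _ (Finset.mem_univ _))))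
  have hfi : ∀ h, c * f * (s h)⁻¹ ∈ R := fun h => by
    rw [mul_assoc]
    exact R.mul_mem hcmem (hft _ (Finset.mem_union_right _
      (Finset.mem_image_of_mem (fun h => (s h)⁻¹) (Finset.mem_univ _))))
  have hcen' : c * f ∈ Set.center D := Set.mul_mem_center hc hf
  have hfac : ∀ g, g ≠ 0 → ∃ h n, s h ≠ 0 ∧ π n = 1 ∧ g = s h * n := by
    intro g hg
    have hg0 : π g ≠ 0 := by rwa [Ne, map_eq_zero]
    have hs0 : s (π g) ≠ 0 := ne_zero_of_map_ne_zero (π := π) (by rwa [hs])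
    refine ⟨π g, (s (π g))⁻¹ * g, hs0, ?_, (mul_inv_cancel_left₀ hs0 g).symm⟩
    rw [map_mul, map_inv₀, hs, inv_mul_cancel₀ hg0]
  refine ⟨c * f, hcen', mul_ne_zero hc0 hf0, R.mul_mem hcmem hfR, fun r hr => ?_,
    fun g hg r hr => ?_, fun g hg => ?_⟩
  · rw [mul_assoc]; exact hcR _ (R.mul_mem hfR hr)
  · obtain ⟨h, n, hsh, hn, rfl⟩ := hfac g hg
    have := R.mul_mem (R.mul_mem (hfs h) (hR.conj_mem n hn r hr)) (hfi h)
    convert this using 1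
    rw [pow_two, mul_inv_rev]
    generalize c * f = e at hcen'
    rw [← mul_assoc _ e, ← commute_of_mem_center hcen' (e * s h * _)]
    simp only [mul_assoc]
  · obtain ⟨h, n, hsh, hn, rfl⟩ := hfac g hg
    rcases hR.total n hn with h' | h'
    · left; rw [← mul_assoc]; exact R.mul_mem (hfs h) h'
    · right
      rw [mul_inv_rev, ← mul_assoc, commute_of_mem_center hcen', mul_assoc]
      exact R.mul_mem h' (hfi h)

lemma IsScale.inv_notMem {e : D} (he : IsScale π R e) : e⁻¹ ∉ R := fun h => by
  have := he.map_one_add _ (R.neg_mem h)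
  rw [mul_neg, mul_inv_cancel₀ he.ne_zero, add_neg_cancel, map_zero] at this
  exact zero_ne_one this

lemma IsScale.commute {e : D} (he : IsScale π R e) (a : D) : Commute e a :=
  he.mem_center.comm a

lemma IsScale.pow_mul_mem_of_le {e : D} (he : IsScale π R e) {k l : ℕ} {t : D} (hkl : k ≤ l)
    (h : e ^ k * t ∈ R) : e ^ l * t ∈ R := by
  obtain ⟨j, rfl⟩ := Nat.exists_eq_add_of_le hkl
  rw [add_comm, pow_add, mul_assoc]
  exact R.mul_mem (R.pow_mem he.mem _) h

/-- The ring obtained by inverting a scale. -/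
def IsScale.localization {e : D} (he : IsScale π R e) : Subring D where
  carrier := {t | ∃ k : ℕ, e ^ k * t ∈ R}
  zero_mem' := ⟨0, by simp⟩
  one_mem' := ⟨0, by simp⟩
  add_mem' := by
    rintro s t ⟨k, hk⟩ ⟨l, hl⟩
    refine ⟨max k l, ?_⟩
    rw [mul_add]
    exact R.add_mem (he.pow_mul_mem_of_le (le_max_left _ _) hk)
      (he.pow_mul_mem_of_le (le_max_right _ _) hl)
  neg_mem' := by
    rintro t ⟨k, hk⟩
    exact ⟨k, by rw [mul_neg]; exact R.neg_mem hk⟩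
  mul_mem' := by
    rintro s t ⟨k, hk⟩ ⟨l, hl⟩
    refine ⟨k + l, ?_⟩
    rw [pow_add, mul_assoc, ← mul_assoc _ s, ((he.commute s).pow_left l).eq, mul_assoc,
      ← mul_assoc]
    exact R.mul_mem hk hl

lemma IsScale.isInvariantValuationRing_localization {e : D} (he : IsScale π R e) :
    IsInvariantValuationRing π he.localization := by
  refine ⟨fun t => ?_, fun g hg r hr => ?_, fun t ht hti => ?_⟩
  · by_cases ht : t = 0
    · left; rw [ht]; exact zero_mem _
    · exact (he.total t ht).imp (fun h => ⟨1, by rwa [pow_one]⟩) fun h => ⟨1, by rwa [pow_one]⟩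
  · obtain ⟨k, hk⟩ := hr
    refine ⟨2 + k, ?_⟩
    have := he.conj_mem g hg _ hk
    rwa [← mul_assoc g, ← ((he.commute g).pow_left k).eq, mul_assoc _ g, mul_assoc (e ^ k),
      ← mul_assoc (e ^ 2), ← pow_add] at this
  · have ht0 : t ≠ 0 := by
      rintro rfl; rw [inv_zero] at hti; exact hti (zero_mem _)
    -- The exponent leaves room for one factor: the first alternative is e⁻¹t ∈ R, so 1 + t = 1 +
    -- e(e⁻¹t); the second puts e³t⁻¹ in R and makes t a unit.
    have h := he.total (e⁻¹ * e⁻¹ * t) (by simp [ht0, he.ne_zero])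
    rcases h with h | h
    · rw [mul_assoc, mul_inv_cancel_left₀ he.ne_zero] at h
      have := he.map_one_add _ h
      rwa [mul_inv_cancel_left₀ he.ne_zero] at this
    · exfalso
      apply hti
      refine ⟨3, ?_⟩
      have h2 : e ^ 3 * t⁻¹ = e * (e⁻¹ * e⁻¹ * t)⁻¹ := by
        rw [mul_inv_rev, mul_inv_rev, inv_inv, ← ((he.commute t⁻¹).mul_left (he.commute t⁻¹)).eq]
        simp only [pow_succ, pow_zero, one_mul, mul_assoc]
      rwa [h2]

lemma IsScale.localization_le {e f : D} (he : IsScale π R e) (hf : IsScale π R f)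
    (h : e⁻¹ * f ∈ R) : he.localization ≤ hf.localization := by
  rintro t ⟨k, hk⟩
  refine ⟨k, ?_⟩
  have := R.mul_mem (R.pow_mem h k) hk
  rwa [(hf.commute e⁻¹).symm.mul_pow, ((hf.commute (e⁻¹ ^ k)).pow_left k).symm.eq,
    mul_assoc (f ^ k), ← mul_assoc (e⁻¹ ^ k), inv_pow,
    inv_mul_cancel₀ (pow_ne_zero _ he.ne_zero), one_mul] at this

/-- An automorphism that preserves `π` and `R` permutes the scales. -/
lemma IsScale.map {e : D} (he : IsScale π R e) (σ : D ≃+* D) (hσ : ∀ t, π (σ t) = π t)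
    (hσR : ∀ r ∈ R, σ r ∈ R) (hσR' : ∀ r ∈ R, σ.symm r ∈ R) : IsScale π R (σ e) := by
  refine ⟨?_, by simpa using he.ne_zero, hσR _ he.mem, fun r hr => ?_, fun g hg r hr => ?_,
    fun g hg => ?_⟩
  · rw [Semigroup.mem_center_iff]
    intro a
    have := congrArg σ (commute_of_mem_center he.mem_center (σ.symm a))
    rw [map_mul, map_mul, σ.apply_symm_apply] at this
    exact this.symm
  · have := he.map_one_add _ (hσR' r hr)
    rw [← hσ, map_add, map_mul, map_one, σ.apply_symm_apply] at this
    exact this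
  · have := hσR _ (he.conj_mem (σ.symm g) (by simpa using hg) _ (hσR' r hr))
    simpa using this
  · have := he.total (σ.symm g) (by simpa using hg)
    exact this.imp (fun h => by simpa using hσR _ h) fun h => by simpa using hσR _ h

/-- Used twice: for the chain of localizations at the scales, and for the chains in the final appeal
to Zorn's lemma. -/
lemma isInvariantValuationRing_sInf {c : Set (Subring D)}
    (hc : ∀ O ∈ c, IsInvariantValuationRing π O) (hchain : IsChain (· ≤ ·) c) :
    IsInvariantValuationRing π (sInf c) := by
  refine ⟨fun t => ?_, fun g hg r hr => ?_, fun t ht hti => ?_⟩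
  · by_contra! h
    simp only [Subring.mem_sInf, not_forall] at h
    obtain ⟨⟨O₁, h₁, ht₁⟩, ⟨O₂, h₂, ht₂⟩⟩ := h
    rcases hchain.total h₁ h₂ with hle | hle
    · exact ((hc O₁ h₁).total t).elim ht₁ fun h => ht₂ (hle h)
    · exact ((hc O₂ h₂).total t).elim (fun h => ht₁ (hle h)) ht₂
  · rw [Subring.mem_sInf] at hr ⊢
    exact fun O hO => (hc O hO).conj_mem g hg r (hr O hO)
  · simp only [Subring.mem_sInf, not_forall] at ht hti
    obtain ⟨O, hO, h⟩ := hti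
    exact (hc O hO).map_one_add t (ht O hO) h

/-- If inverting some scale does not produce the whole division ring, then inverting all scales
produces an invariant valuation ring that is stable under automorphisms. -/
lemma IsKernelSubring.exists_invariantValuationRing_of_ne_top (hR : IsKernelSubring π R)
    (hcen : ∀ c ∈ Set.center D, c ≠ 0 → π c = 1) {e t : D} (he : IsScale π R e)
    (hne : ∀ k : ℕ, e ^ k * t ∉ R) :
    ∃ O : Subring D, IsInvariantValuationRing π O ∧ O ≠ ⊤ ∧
      ∀ σ : D ≃+* D, (∀ t, π (σ t) = π t) → (∀ r ∈ R, σ r ∈ R) → (∀ r ∈ R, σ.symm r ∈ R) →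
        ∀ t ∈ O, σ t ∈ O := by
  let c : Set (Subring D) := {O | ∃ (f : D) (hf : IsScale π R f), O = hf.localization}
  refine ⟨sInf c, isInvariantValuationRing_sInf ?_ ?_, fun htop => ?_,
    fun σ hσ hσR hσR' u hu => ?_⟩
  · rintro _ ⟨f, hf, rfl⟩
    exact hf.isInvariantValuationRing_localization
  · rintro _ ⟨f, hf, rfl⟩ _ ⟨g, hg, rfl⟩ _
    have h1 : π (f⁻¹ * g) = 1 := by
      rw [map_mul, map_inv₀, hcen f hf.mem_center hf.ne_zero, hcen g hg.mem_center hg.ne_zero,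
        inv_one, one_mul]
    rcases hR.total _ h1 with h | h
    · exact Or.inl (hf.localization_le hg h)
    · rw [mul_inv_rev, inv_inv] at h
      exact Or.inr (hg.localization_le hf h)
  · have h1 : t ∈ sInf c := htop ▸ Subring.mem_top t
    obtain ⟨k, hk⟩ := Subring.mem_sInf.1 h1 _ ⟨e, he, rfl⟩
    exact hne k hk
  · rw [Subring.mem_sInf] at hu ⊢
    rintro _ ⟨f, hf, rfl⟩
    have hf' := hf.map σ.symm (fun t => by rw [← hσ, σ.apply_symm_apply]) hσR' hσR
    obtain ⟨k, hk⟩ := hu _ ⟨_, hf', rfl⟩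
    exact ⟨k, by simpa using hσR _ hk⟩

/-- The order of an element with respect to the filtration by the powers of the scale. -/
lemma IsScale.exists_order {e : D} (he : IsScale π R e) (hall : ∀ t, ∃ k : ℕ, e ^ k * t ∈ R) :
    ∃ ρ : D → ℤ, ∀ t, t ≠ 0 → ∀ j : ℤ, e ^ (-j) * t ∈ R ↔ j ≤ ρ t := by
  have he0 := he.ne_zero
  have : ∀ t, t ≠ 0 → ∃ k : ℤ, ∀ j : ℤ, e ^ (-j) * t ∈ R ↔ j ≤ k := by
    intro t ht
    obtain ⟨k, hk⟩ := hall t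
    obtain ⟨l, hl⟩ := hall t⁻¹
    have hdown : ∀ i j : ℤ, i ≤ j → e ^ (-j) * t ∈ R → e ^ (-i) * t ∈ R := by
      intro i j hij h
      obtain ⟨d, hd⟩ := Int.eq_ofNat_of_zero_le (sub_nonneg.2 hij)
      have h1 : e ^ (-i) * t = e ^ d * (e ^ (-j) * t) := by
        rw [← mul_assoc, ← zpow_natCast, ← zpow_add₀ he0]
        congr 2; omega
      rw [h1]; exact R.mul_mem (R.pow_mem he.mem _) h
    -- With e^l t⁻¹ in R, an exponent beyond l would put e⁻¹ itself in R.
    have hbdd : ∃ b : ℤ, ∀ z : ℤ, e ^ (-z) * t ∈ R → z ≤ b := by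
      refine ⟨l, fun z hz => ?_⟩
      by_contra! hlt
      apply he.inv_notMem
      have h1 := hdown (l + 1) z hlt hz
      have h2 := R.mul_mem h1 hl
      have h3 : e ^ (-((l : ℤ) + 1)) * t * (e ^ l * t⁻¹) = e⁻¹ := by
        rw [((he.commute t⁻¹).pow_left l).eq, mul_assoc, mul_inv_cancel_left₀ ht,
          ← zpow_natCast, ← zpow_add₀ he0]
        simp
      rwa [h3] at h2
    obtain ⟨u, hu, hmax⟩ := Int.exists_greatest_of_bdd (P := fun z => e ^ (-z) * t ∈ R) hbdd
      ⟨-k, by simpa using hk⟩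
    exact ⟨u, fun j => ⟨hmax j, fun h => hdown j u h hu⟩⟩
  choose! ρ hρ using this
  exact ⟨ρ, hρ⟩

end Scale

/-! ### Homogenization and real valuations -/

/-- In a preordered monoid with `m * n ≤ n * m`, sorting the factors of `(n * m) ^ i` is
monotone. -/
lemma rel_mul_pow_of_rel_mul_comm {M : Type*} [Monoid M] (N : Submonoid M) (r : M → M → Prop)
    (hrefl : ∀ a ∈ N, r a a) (htrans : ∀ a b c, r a b → r b c → r a c)
    (hl : ∀ c ∈ N, ∀ a b, r a b → r (c * a) (c * b))
    (hr : ∀ c ∈ N, ∀ a b, r a b → r (a * c) (b * c)) {n m : M} (hn : n ∈ N) (hm : m ∈ N)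
    (h : r (m * n) (n * m)) (i : ℕ) :
    r ((n * m) ^ i) (n ^ i * m ^ i) ∧ r (m ^ i * n ^ i) ((n * m) ^ i) := by
  have h1 : ∀ i : ℕ, r (m * n ^ i) (n ^ i * m) := by
    intro i
    induction i with
    | zero => simpa using hrefl m hm
    | succ i ih =>
      have a1 := hr n hn _ _ ih
      have a2 := hl _ (N.pow_mem hn i) _ _ h
      rw [mul_assoc, ← pow_succ] at a1
      rw [← mul_assoc, ← mul_assoc, ← pow_succ] at a2
      exact htrans _ _ _ a1 a2
  have h2 : ∀ i : ℕ, r (m ^ i * n) (n * m ^ i) := by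
    intro i
    induction i with
    | zero => simpa using hrefl n hn
    | succ i ih =>
      have a1 := hl m hm _ _ ih
      have a2 := hr _ (N.pow_mem hm i) _ _ h
      rw [← mul_assoc, ← mul_assoc, ← pow_succ'] at a1
      rw [mul_assoc n, ← pow_succ'] at a2
      exact htrans _ _ _ a1 a2
  induction i with
  | zero => simpa using hrefl 1 N.one_mem
  | succ i ih =>
    constructor
    · have a1 := hr _ (N.mul_mem hn hm) _ _ ih.1
      have a2 := hl _ (N.pow_mem hn i) _ _ (hr m hm _ _ (h2 i))
      rw [← pow_succ, ← mul_assoc, mul_assoc (n ^ i)] at a1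
      rw [mul_assoc n, ← mul_assoc (n ^ i) n, ← pow_succ, ← pow_succ, ← mul_assoc] at a2
      exact htrans _ _ _ a1 a2
    · have a1 := hl _ (N.pow_mem hm i) _ _ (h1 (i + 1))
      have a2 := hr _ (N.mul_mem hn hm) _ _ ih.2
      rw [← mul_assoc, ← pow_succ] at a1
      have e1 : m ^ i * n ^ i * (n * m) = m ^ i * (n ^ (i + 1) * m) := by
        simp only [pow_succ, mul_assoc]
      rw [e1, ← pow_succ] at a2
      exact htrans _ _ _ a1 a2

open Filter Topology in
/-- Homogenization: an integer valued map that is additive up to a bounded error from below has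
a linear growth rate along powers. -/
lemma exists_growth_rate {D : Type*} [DivisionRing D] (ρ : D → ℤ) (C : ℤ)
    (hlo : ∀ a b, a ≠ 0 → b ≠ 0 → ρ a + ρ b ≤ ρ (a * b))
    (hhi : ∀ a b, a ≠ 0 → b ≠ 0 → ρ (a * b) ≤ ρ a + ρ b + C) :
    ∃ w : D → ℝ, ∀ g, g ≠ 0 → Tendsto (fun i : ℕ => (ρ (g ^ i) : ℝ) / i) atTop (𝓝 (w g)) ∧
      (ρ g : ℝ) ≤ w g ∧ w g ≤ ρ g + C := by
  have : ∀ g, g ≠ 0 → ∃ l : ℝ, Tendsto (fun i : ℕ => (ρ (g ^ i) : ℝ) / i) atTop (𝓝 l) ∧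
      (ρ g : ℝ) ≤ l ∧ l ≤ ρ g + C := by
    intro g hg
    have hbound : ∀ i : ℕ, (i + 1 : ℤ) * ρ g ≤ ρ (g ^ (i + 1)) ∧
        ρ (g ^ (i + 1)) ≤ (i + 1 : ℤ) * ρ g + i * C := by
      intro i
      induction i with
      | zero => simp
      | succ i ih =>
        have h1 := hlo (g ^ (i + 1)) g (pow_ne_zero _ hg) hg
        have h2 := hhi (g ^ (i + 1)) g (pow_ne_zero _ hg) hg
        rw [← pow_succ] at h1 h2
        push_cast
        constructor <;> linarith [ih.1, ih.2]
    have hC : 0 ≤ C := by linarith [hlo g g hg hg, hhi g g hg hg]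
    have hev : ∀ i : ℕ, 1 ≤ i →
        (ρ g : ℝ) ≤ (ρ (g ^ i) : ℝ) / i ∧ (ρ (g ^ i) : ℝ) / i ≤ ρ g + C := by
      intro i hi
      obtain ⟨j, rfl⟩ := Nat.exists_eq_add_of_le' hi
      have hpos : (0 : ℝ) < ((j + 1 : ℕ) : ℝ) := by positivity
      obtain ⟨h1, h2⟩ := hbound j
      have h1' : ((j + 1 : ℤ) * ρ g : ℝ) ≤ ρ (g ^ (j + 1)) := by exact_mod_cast h1
      have h2' : (ρ (g ^ (j + 1)) : ℝ) ≤ (j + 1 : ℤ) * ρ g + j * C := by exact_mod_cast h2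
      have hC' : (0 : ℝ) ≤ C := by exact_mod_cast hC
      rw [le_div_iff₀ hpos, div_le_iff₀ hpos]
      push_cast at *
      constructor <;> nlinarith
    have hsub : Subadditive fun i : ℕ => -(ρ (g ^ i) : ℝ) := by
      intro i j
      have := hlo (g ^ i) (g ^ j) (pow_ne_zero _ hg) (pow_ne_zero _ hg)
      rw [← pow_add] at this
      have : (ρ (g ^ i) : ℝ) + ρ (g ^ j) ≤ ρ (g ^ (i + j)) := by exact_mod_cast this
      linarith
    have hbdd : BddBelow (Set.range fun i : ℕ => -(ρ (g ^ i) : ℝ) / i) := by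
      -- The 0 covers i = 0, where the quotient by zero is 0. Fekete's lemma then gives the limit.
      refine ⟨min 0 (-(ρ g + C)), ?_⟩
      rintro _ ⟨i, rfl⟩
      rcases Nat.eq_zero_or_pos i with rfl | hi
      · simp
      · refine (min_le_right _ _).trans ?_
        have := (hev i hi).2
        show _ ≤ -(ρ (g ^ i) : ℝ) / i
        rw [neg_div]; linarith
    have hlim := (hsub.tendsto_lim hbdd).neg
    have hlim' : Tendsto (fun i : ℕ => (ρ (g ^ i) : ℝ) / i) atTop (𝓝 (-hsub.lim)) := by
      refine hlim.congr fun i => ?_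
      rw [neg_div, neg_neg]
    refine ⟨_, hlim', ge_of_tendsto hlim' ?_, le_of_tendsto hlim' ?_⟩
    · filter_upwards [eventually_ge_atTop 1] with i hi using (hev i hi).1
    · filter_upwards [eventually_ge_atTop 1] with i hi using (hev i hi).2
  choose! w hw using this
  exact ⟨w, hw⟩

section RealValuation

variable {D H : Type*} [DivisionRing D] [GroupWithZero H] {π : D →*₀ H} {R : Subring D}

/-- Averaging a map that is additive on the kernel of `π` over the cosets of the kernel. -/
lemma exists_additive_extension [Finite H] (hsurj : Function.Surjective π) (w : D → ℝ)
    (hw : ∀ n m, π n = 1 → π m = 1 → w (n * m) = w n + w m) (ρ : D → ℤ) (C : ℤ)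
    (hlo : ∀ a b, a ≠ 0 → b ≠ 0 → ρ a + ρ b ≤ ρ (a * b))
    (hhi : ∀ a b, a ≠ 0 → b ≠ 0 → ρ (a * b) ≤ ρ a + ρ b + C)
    (hρ : ∀ g, g ≠ 0 → (ρ g : ℝ) ≤ w g ∧ w g ≤ ρ g + C) :
    ∃ (W : D → ℝ) (N : ℕ) (B : ℝ), 0 < N ∧
      (∀ a b, a ≠ 0 → b ≠ 0 → W (a * b) = W a + W b) ∧
      ∀ g, g ≠ 0 → |W g - N * ρ g| ≤ B := by
  classical
  cases nonempty_fintype H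
  choose s hs using hsurj
  have hs0 : ∀ u : Hˣ, s u ≠ 0 := fun u =>
    ne_zero_of_map_ne_zero (π := π) (by rw [hs]; exact u.ne_zero)
  -- This is the transfer to the kernel followed by w. The bound is summed over all pairs (u, v)
  -- only to be independent of g.
  refine ⟨fun g => ∑ u : Hˣ, w ((s (π g * u))⁻¹ * g * s u), Fintype.card Hˣ,
    ∑ u : Hˣ, ∑ v : Hˣ, (|(ρ (s v)⁻¹ : ℝ)| + |(ρ (s u) : ℝ)| + 3 * |(C : ℝ)|),
    Fintype.card_pos, ?_, ?_⟩
  · intro a b ha hb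
    have hb' : π b ≠ 0 := by rwa [Ne, map_eq_zero]
    have ha' : π a ≠ 0 := by rwa [Ne, map_eq_zero]
    beta_reduce
    rw [← Equiv.sum_comp (Equiv.mulLeft (Units.mk0 (π b) hb'))
      fun u : Hˣ => w ((s (π a * u))⁻¹ * a * s u), ← Finset.sum_add_distrib]
    refine Finset.sum_congr rfl fun u _ => ?_
    rw [← hw]
    · congr 1
      have h0 := hs0 (Units.mk0 (π b) hb' * u)
      simp only [Equiv.coe_mulLeft, Units.val_mul, Units.val_mk0, map_mul] at h0 ⊢
      rw [← mul_assoc (_ * a * _), ← mul_assoc (_ * a * _), mul_inv_cancel_right₀ h0]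
      simp only [mul_assoc]
    · simp only [Equiv.coe_mulLeft, Units.val_mul, Units.val_mk0, map_mul, map_inv₀, hs]
      rw [mul_assoc, inv_mul_cancel₀]
      exact mul_ne_zero ha' (mul_ne_zero hb' u.ne_zero)
    · simp only [map_mul, map_inv₀, hs]
      rw [mul_assoc, inv_mul_cancel₀]
      exact mul_ne_zero hb' u.ne_zero
  · intro g hg
    have hg' : π g ≠ 0 := by rwa [Ne, map_eq_zero]
    have hcard : (Fintype.card Hˣ : ℝ) * ρ g = ∑ u : Hˣ, (ρ g : ℝ) := by
      rw [Finset.sum_const, Finset.card_univ, nsmul_eq_mul]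
    show |∑ u : Hˣ, w ((s (π g * u))⁻¹ * g * s u) - (Fintype.card Hˣ : ℝ) * ρ g| ≤ _
    rw [hcard, ← Finset.sum_sub_distrib]
    refine (Finset.abs_sum_le_sum_abs _ _).trans (Finset.sum_le_sum fun u _ => ?_)
    set v : Hˣ := Units.mk0 (π g) hg' * u with hv
    have hvu : π g * u = (v : H) := by rw [hv, Units.val_mul, Units.val_mk0]
    have hle : |w ((s v)⁻¹ * g * s u) - ρ g| ≤
        |(ρ (s v)⁻¹ : ℝ)| + |(ρ (s u) : ℝ)| + 3 * |(C : ℝ)| := by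
      have hv0 := inv_ne_zero (hs0 v)
      have h1 := hlo ((s v)⁻¹ * g) (s u) (mul_ne_zero hv0 hg) (hs0 u)
      have h2 := hhi ((s v)⁻¹ * g) (s u) (mul_ne_zero hv0 hg) (hs0 u)
      have h3 := hlo (s v)⁻¹ g hv0 hg
      have h4 := hhi (s v)⁻¹ g hv0 hg
      have h5 := hρ ((s v)⁻¹ * g * s u) (mul_ne_zero (mul_ne_zero hv0 hg) (hs0 u))
      have h6 : (ρ (s v)⁻¹ : ℝ) + ρ g + ρ (s u) ≤ ρ ((s v)⁻¹ * g * s u) := by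
        exact_mod_cast (add_le_add_left h3 _).trans h1
      have h7 : (ρ ((s v)⁻¹ * g * s u) : ℝ) ≤ ρ (s v)⁻¹ + ρ g + C + ρ (s u) + C := by
        exact_mod_cast h2.trans (add_le_add_left (add_le_add_left h4 _) _)
      rw [abs_le]
      have a1 := neg_abs_le (ρ (s v)⁻¹ : ℝ)
      have a2 := neg_abs_le (ρ (s u) : ℝ)
      have a3 := le_abs_self (ρ (s v)⁻¹ : ℝ)
      have a4 := le_abs_self (ρ (s u) : ℝ)
      have a5 := le_abs_self (C : ℝ)
      have a6 := abs_nonneg (C : ℝ)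
      constructor <;> linarith [h5.1, h5.2]
    rw [hvu]
    exact hle.trans (Finset.single_le_sum
      (f := fun v : Hˣ => |(ρ (s v)⁻¹ : ℝ)| + |(ρ (s u) : ℝ)| + 3 * |(C : ℝ)|)
      (fun v _ => by positivity) (Finset.mem_univ v))

lemma add_eq_of_abs_sub_le_const {f g h : ℕ → ℝ} {a b c C : ℝ}
    (hf : Filter.Tendsto (fun i : ℕ => f i / i) Filter.atTop (nhds a))
    (hg : Filter.Tendsto (fun i : ℕ => g i / i) Filter.atTop (nhds b))
    (hh : Filter.Tendsto (fun i : ℕ => h i / i) Filter.atTop (nhds c))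
    (hle : ∀ i, |f i - (g i + h i)| ≤ C) : a = b + c := by
  have h1 : Filter.Tendsto (fun i : ℕ => f i / i - (g i / i + h i / i)) Filter.atTop
      (nhds (a - (b + c))) := hf.sub (hg.add hh)
  have h2 : Filter.Tendsto (fun i : ℕ => f i / i - (g i / i + h i / i)) Filter.atTop
      (nhds 0) := by
    refine squeeze_zero_norm (fun i => ?_) (tendsto_const_div_atTop_nhds_zero_nat C)
    rw [← add_div, ← sub_div, Real.norm_eq_abs, abs_div, Nat.abs_cast]
    exact div_le_div_of_nonneg_right (hle i) (Nat.cast_nonneg i)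
  linarith [tendsto_nhds_unique h1 h2]

/-- If inverting the scale produces the whole division ring, there is a real valuation such that
elements of large value are close to zero. -/
theorem IsScale.exists_real_valuation [Finite H] (hsurj : Function.Surjective π)
    (hR : IsKernelSubring π R) {e : D} (he : IsScale π R e)
    (hall : ∀ t, ∃ k : ℕ, e ^ k * t ∈ R) :
    ∃ (W : D → ℝ) (B : ℝ), (∀ a b, a ≠ 0 → b ≠ 0 → W (a * b) = W a + W b) ∧
      (∀ a, a ≠ 0 → 1 + a ≠ 0 → 0 ≤ W a → 0 ≤ W (1 + a)) ∧
      (∀ t, t ≠ 0 → B < W t → π (1 + t) = 1) ∧ (∃ t, t ≠ 0 ∧ W t < 0) ∧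
      ∀ t, t ≠ 0 → (0 ≤ W t ↔ ∃ k : ℕ, ∀ i : ℕ, e ^ k * t ^ i ∈ R) := by
  have he0 := he.ne_zero
  obtain ⟨ρ, hρ⟩ := he.exists_order hall
  have hmem : ∀ t, t ≠ 0 → e ^ (-ρ t) * t ∈ R := fun t ht => (hρ t ht _).2 le_rfl
  have hez : ∀ (j : ℤ) (t : D), e ^ j * t = t * e ^ j := fun j t =>
    ((he.commute t).zpow_left₀ j).eq
  have hlo : ∀ a b, a ≠ 0 → b ≠ 0 → ρ a + ρ b ≤ ρ (a * b) := by
    intro a b ha hb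
    rw [← hρ _ (mul_ne_zero ha hb)]
    have := R.mul_mem (hmem a ha) (hmem b hb)
    rwa [mul_assoc, ← mul_assoc a, ← hez, mul_assoc, ← mul_assoc (e ^ _), ← zpow_add₀ he0,
      ← neg_add] at this
  -- Totality is applied to e^(-(ρ g + 2)) g: the first alternative would give g order at least ρ g
  -- + 1, and the second gives exactly this bound.
  have hinv : ∀ g, g ≠ 0 → -ρ g - 3 ≤ ρ g⁻¹ := by
    intro g hg
    rw [← hρ _ (inv_ne_zero hg)]
    have h1 := he.total (e ^ (-(ρ g + 2)) * g) (mul_ne_zero (zpow_ne_zero _ he0) hg)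
    rcases h1 with h1 | h1
    · rw [← mul_assoc, ← zpow_one_add₀ he0, show 1 + -(ρ g + 2) = -(ρ g + 1) by ring,
        hρ g hg] at h1
      omega
    · rw [mul_inv_rev, ← zpow_neg, ← hez, ← mul_assoc, ← zpow_one_add₀ he0] at h1
      rwa [show -(-ρ g - 3) = 1 + - -(ρ g + 2) by ring]
  have hhi : ∀ a b, a ≠ 0 → b ≠ 0 → ρ (a * b) ≤ ρ a + ρ b + 3 := by
    intro a b ha hb
    have h1 := hlo (a * b) b⁻¹ (mul_ne_zero ha hb) (inv_ne_zero hb)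
    rw [mul_inv_cancel_right₀ hb] at h1
    linarith [hinv b hb]
  obtain ⟨w, hw⟩ := exists_growth_rate ρ 3 hlo hhi
  have hmono : ∀ a b, a ≠ 0 → b ≠ 0 → a⁻¹ * b ∈ R → ρ a ≤ ρ b := by
    intro a b ha hb h
    have h1 := hlo a (a⁻¹ * b) ha (mul_ne_zero (inv_ne_zero ha) hb)
    rw [mul_inv_cancel_left₀ ha] at h1
    have h2 : 0 ≤ ρ (a⁻¹ * b) := by
      rw [← hρ _ (mul_ne_zero (inv_ne_zero ha) hb)]; simpa using h
    linarith
  -- In the preorder on the kernel, (nm)^i lies between n^i m^i and m^i n^i, so its order is that of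
  -- n^i plus that of m^i up to a bounded error, which vanishes in the growth rate.
  have hwadd : ∀ n m, π n = 1 → π m = 1 → w (n * m) = w n + w m := by
    intro n m hn hm
    have hn0 := ne_zero_of_map_eq_one hn
    have hm0 := ne_zero_of_map_eq_one hm
    let N : Submonoid D :=
      { carrier := {a | π a = 1}
        one_mem' := map_one π
        mul_mem' := fun {a b} (ha : π a = 1) (hb : π b = 1) =>
          show π (a * b) = 1 by rw [map_mul, ha, hb, one_mul] }
    have hN0 : ∀ a ∈ N, a ≠ 0 := fun a ha => ne_zero_of_map_eq_one ha
    let r : D → D → Prop := fun a b => a ∈ N ∧ b ∈ N ∧ a⁻¹ * b ∈ R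
    have hrefl : ∀ a ∈ N, r a a := fun a ha =>
      ⟨ha, ha, by rw [inv_mul_cancel₀ (hN0 a ha)]; exact R.one_mem⟩
    have htrans : ∀ a b c, r a b → r b c → r a c := fun a b c hab hbc =>
      ⟨hab.1, hbc.2.1, by
        have := R.mul_mem hab.2.2 hbc.2.2
        rwa [mul_assoc, mul_inv_cancel_left₀ (hN0 b hab.2.1)] at this⟩
    have hl : ∀ c ∈ N, ∀ a b, r a b → r (c * a) (c * b) := fun c hc a b hab =>
      ⟨N.mul_mem hc hab.1, N.mul_mem hc hab.2.1, by
        rw [mul_inv_rev, mul_assoc, inv_mul_cancel_left₀ (hN0 c hc)]; exact hab.2.2⟩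
    have hr : ∀ c ∈ N, ∀ a b, r a b → r (a * c) (b * c) := fun c hc a b hab =>
      ⟨N.mul_mem hab.1 hc, N.mul_mem hab.2.1 hc, by
        have := hR.conj_mem c⁻¹ (map_inv_eq_one hc) _ hab.2.2
        rwa [inv_inv, ← mul_assoc, mul_assoc, ← mul_inv_rev] at this⟩
    have hpow : ∀ i : ℕ, |(ρ ((n * m) ^ i) : ℝ) - (ρ (n ^ i) + ρ (m ^ i))| ≤ 3 := by
      intro i
      have hni := pow_ne_zero i hn0
      have hmi := pow_ne_zero i hm0
      have hnmi := pow_ne_zero i (mul_ne_zero hn0 hm0)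
      have b1 := hlo _ _ hni hmi
      have b2 := hhi _ _ hni hmi
      have b3 := hlo _ _ hmi hni
      have b4 := hhi _ _ hmi hni
      have key : ρ (n ^ i) + ρ (m ^ i) ≤ ρ ((n * m) ^ i) ∧
          ρ ((n * m) ^ i) ≤ ρ (n ^ i) + ρ (m ^ i) + 3 := by
        have htot : r (m * n) (n * m) ∨ r (n * m) (m * n) := by
          have hmn : m * n ∈ N := N.mul_mem hm hn
          have hnm : n * m ∈ N := N.mul_mem hn hm
          rcases hR.total ((m * n)⁻¹ * (n * m)) (by simp [hm, hn]) with h | h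
          · exact Or.inl ⟨hmn, hnm, h⟩
          · rw [mul_inv_rev (m * n)⁻¹, inv_inv] at h
            exact Or.inr ⟨hnm, hmn, h⟩
        rcases htot with h | h
        · obtain ⟨h1, h2⟩ := rel_mul_pow_of_rel_mul_comm N r hrefl htrans hl hr hn hm h i
          have c1 := hmono _ _ hnmi (mul_ne_zero hni hmi) h1.2.2
          have c2 := hmono _ _ (mul_ne_zero hmi hni) hnmi h2.2.2
          constructor <;> linarith
        · obtain ⟨h1, h2⟩ := rel_mul_pow_of_rel_mul_comm N (fun a b => r b a) hrefl
            (fun a b c hab hbc => htrans c b a hbc hab) (fun c hc a b => hl c hc b a)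
            (fun c hc a b => hr c hc b a) hn hm h i
          have c1 := hmono _ _ (mul_ne_zero hni hmi) hnmi h1.2.2
          have c2 := hmono _ _ hnmi (mul_ne_zero hmi hni) h2.2.2
          constructor <;> linarith
      have k1 : (ρ (n ^ i) : ℝ) + ρ (m ^ i) ≤ ρ ((n * m) ^ i) := by exact_mod_cast key.1
      have k2 : (ρ ((n * m) ^ i) : ℝ) ≤ ρ (n ^ i) + ρ (m ^ i) + 3 := by exact_mod_cast key.2
      rw [abs_le]; constructor <;> linarith
    exact add_eq_of_abs_sub_le_const (hw _ (mul_ne_zero hn0 hm0)).1 (hw _ hn0).1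
      (hw _ hm0).1 hpow
  obtain ⟨W, N, B, hN, hWadd, hWρ⟩ := exists_additive_extension hsurj w hwadd ρ 3 hlo hhi
    fun g hg => (hw g hg).2
  have hNR : (0 : ℝ) < N := by exact_mod_cast hN
  have hW1 : W 1 = 0 := by
    have := hWadd 1 1 one_ne_zero one_ne_zero
    rw [one_mul] at this; linarith
  have hWpow : ∀ g, g ≠ 0 → ∀ i : ℕ, W (g ^ i) = i * W g := by
    intro g hg i
    induction i with
    | zero => simp [hW1]
    | succ i ih =>
      rw [pow_succ, hWadd _ _ (pow_ne_zero _ hg) hg, ih]; push_cast; ring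
  obtain ⟨c, hc⟩ := exists_nat_ge (B / N)
  have hpowmem : ∀ a, a ≠ 0 → 0 ≤ W a → ∀ j : ℕ, e ^ c * a ^ j ∈ R := by
    intro a ha hWa j
    have h1 := hWρ (a ^ j) (pow_ne_zero _ ha)
    rw [hWpow a ha, abs_le] at h1
    have h2 : (0 : ℝ) ≤ j * W a := mul_nonneg (Nat.cast_nonneg _) hWa
    have h3 : -(c : ℝ) ≤ ρ (a ^ j) := by
      rw [div_le_iff₀ hNR] at hc
      by_contra! hlt
      nlinarith [mul_lt_mul_of_pos_left hlt hNR]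
    have h4 : -(c : ℤ) ≤ ρ (a ^ j) := by exact_mod_cast h3
    rw [← hρ _ (pow_ne_zero _ ha), neg_neg, zpow_natCast] at h4
    exact h4
  have hbounded : ∀ a, a ≠ 0 → ∀ k : ℕ, (∀ i : ℕ, e ^ k * a ^ i ∈ R) → 0 ≤ W a := by
    intro a ha k hk
    by_contra! hneg
    obtain ⟨i, hi⟩ := exists_nat_gt ((N * k + B) / -W a)
    rw [div_lt_iff₀ (by linarith)] at hi
    have h1 := hWρ _ (pow_ne_zero i ha)
    rw [hWpow _ ha, abs_le] at h1
    have h2 : -(k : ℤ) ≤ ρ (a ^ i) := by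
      rw [← hρ _ (pow_ne_zero _ ha), neg_neg, zpow_natCast]; exact hk i
    have h2 : -(k : ℝ) ≤ ρ (a ^ i) := by exact_mod_cast h2
    nlinarith [mul_le_mul_of_nonneg_left h2 hNR.le, h1.1]
  refine ⟨W, N + B, hWadd, fun a ha h1a hWa => ?_, fun t ht hBt => ?_, ?_, fun t ht =>
    ⟨fun h => ⟨c, hpowmem t ht h⟩, fun ⟨k, hk⟩ => hbounded t ht k hk⟩⟩
  -- Nonnegative value is the same as powers bounded by a fixed e^c, a condition that the binomial
  -- expansion of (1 + a)^i passes on to 1 + a.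
  · refine hbounded _ h1a c fun i => ?_
    rw [add_comm, (Commute.one_right a).add_pow, Finset.mul_sum]
    refine R.sum_mem fun j _ => ?_
    rw [one_pow, mul_one, ← mul_assoc]
    exact R.mul_mem (hpowmem a ha hWa j) (natCast_mem R _)
  · have h1 := hWρ t ht
    rw [abs_le] at h1
    have h2 : (0 : ℝ) < ρ t - 1 := by
      by_contra! h
      nlinarith [mul_le_mul_of_nonneg_left h hNR.le]
    have h3 : 1 ≤ ρ t := by
      have : (1 : ℝ) < ρ t := by linarith
      have : (1 : ℤ) < ρ t := by exact_mod_cast this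
      exact this.le
    rw [← hρ t ht, zpow_neg_one] at h3
    have := he.map_one_add _ h3
    rwa [mul_inv_cancel_left₀ he0] at this
  · have hρe : ∀ i : ℕ, ρ (e⁻¹ ^ i) ≤ -(i : ℤ) := by
      intro i
      by_contra! hlt
      have : -(i : ℤ) + 1 ≤ ρ (e⁻¹ ^ i) := by omega
      rw [← hρ _ (pow_ne_zero _ (inv_ne_zero he0)), inv_pow, ← zpow_natCast, ← zpow_neg,
        ← zpow_add₀ he0, show -(-(i : ℤ) + 1) + -(i : ℤ) = -1 by ring, zpow_neg_one] at this
      exact he.inv_notMem this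
    obtain ⟨i, hi⟩ := exists_nat_gt (B / N)
    rw [div_lt_iff₀ hNR] at hi
    have hi0 := pow_ne_zero i (inv_ne_zero he0)
    refine ⟨e⁻¹ ^ i, hi0, ?_⟩
    have h1 := hWρ _ hi0
    rw [abs_le] at h1
    have h2 : (ρ (e⁻¹ ^ i) : ℝ) ≤ -(i : ℝ) := by exact_mod_cast hρe i
    nlinarith [mul_le_mul_of_nonneg_left h2 hNR.le]

end RealValuation

/-! ### The congruence filtration of a real valuation -/

section Nilpotent

variable {D L : Type*} [DivisionRing D] [Group L] [IsSimpleGroup L] {π : D →*₀ WithZero L}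

/-- The valuation ring of a real valuation for which elements of large value are close to zero
is an invariant valuation ring, if the kernel of `π` has nonabelian simple quotient. -/
lemma exists_invariantValuationRing_of_real_valuation (hsurj : Function.Surjective π)
    (hna : ¬ ∀ a b : L, a * b = b * a) (W : D → ℝ) (B : ℝ)
    (hWmul : ∀ a b, a ≠ 0 → b ≠ 0 → W (a * b) = W a + W b)
    (hWone : ∀ a, a ≠ 0 → 1 + a ≠ 0 → 0 ≤ W a → 0 ≤ W (1 + a))
    (hWB : ∀ t, t ≠ 0 → B < W t → π (1 + t) = 1) (hWneg : ∃ t, t ≠ 0 ∧ W t < 0) :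
    ∃ O : Subring D, IsInvariantValuationRing π O ∧ O ≠ ⊤ ∧
      ∀ t, t ∈ O ↔ (t ≠ 0 → 0 ≤ W t) := by
  have hW1 : W 1 = 0 := by
    have := hWmul 1 1 one_ne_zero one_ne_zero
    rw [one_mul] at this; linarith
  have hWm1 : W (-1) = 0 := by
    have := hWmul (-1) (-1) (by simp) (by simp)
    rw [neg_one_mul, neg_neg, hW1] at this; linarith
  have hWneg' : ∀ t, t ≠ 0 → W (-t) = W t := fun t ht => by
    rw [← neg_one_mul, hWmul _ _ (by simp) ht, hWm1, zero_add]
  have hWinv : ∀ t, t ≠ 0 → W t⁻¹ = -W t := fun t ht => by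
    have := hWmul t t⁻¹ ht (inv_ne_zero ht)
    rw [mul_inv_cancel₀ ht, hW1] at this; linarith
  let P : ℝ → Set D := fun c => {t | t ≠ 0 → c ≤ W t}
  have hPadd : ∀ c, ∀ s ∈ P c, ∀ t ∈ P c, s + t ∈ P c := by
    have key : ∀ c s t, s ≠ 0 → t ≠ 0 → s + t ≠ 0 → c ≤ W s → W s ≤ W t → c ≤ W (s + t) := by
      intro c s t hs ht hst hcs hle
      have e : s + t = s * (1 + s⁻¹ * t) := by rw [mul_add, mul_one, mul_inv_cancel_left₀ hs]
      have h0 : s⁻¹ * t ≠ 0 := mul_ne_zero (inv_ne_zero hs) ht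
      have h1 : 1 + s⁻¹ * t ≠ 0 := by rw [e] at hst; exact right_ne_zero_of_mul hst
      rw [e, hWmul _ _ hs h1]
      have := hWone _ h0 h1 (by rw [hWmul _ _ (inv_ne_zero hs) ht, hWinv s hs]; linarith)
      linarith
    intro c s hs t ht hst
    by_cases hs0 : s = 0
    · subst hs0; rw [zero_add] at hst ⊢; exact ht hst
    by_cases ht0 : t = 0
    · subst ht0; rw [add_zero] at hst ⊢; exact hs hst
    rcases le_total (W s) (W t) with h | h
    · exact key c s t hs0 ht0 hst (hs hs0) h
    · rw [add_comm]; exact key c t s ht0 hs0 (by rwa [add_comm]) (ht ht0) h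
  have hPneg : ∀ c, ∀ t ∈ P c, -t ∈ P c := fun c t ht ht0 => by
    have := neg_ne_zero.1 ht0
    rw [hWneg' t this]; exact ht this
  have hPmul : ∀ c d, ∀ s ∈ P c, ∀ t ∈ P d, s * t ∈ P (c + d) := fun c d s hs t ht hst => by
    have h1 := left_ne_zero_of_mul hst
    have h2 := right_ne_zero_of_mul hst
    rw [hWmul _ _ h1 h2]; exact add_le_add (hs h1) (ht h2)
  have hPmono : ∀ c d, d ≤ c → P c ⊆ P d := fun c d h t ht ht0 => h.trans (ht ht0)
  have hunit : ∀ c, 0 < c → ∀ t ∈ P c, 1 + t ≠ 0 ∧ W (1 + t) = 0 := by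
    intro c hc t ht
    have h1 : 1 + t ≠ 0 := by
      intro h
      have : t = -1 := eq_neg_of_add_eq_zero_right h
      have h2 := ht (by rw [this]; simp)
      rw [this, hWm1] at h2; linarith
    refine ⟨h1, le_antisymm ?_ ?_⟩
    · by_contra! hlt
      have h2 : 1 + t ∈ P (min c (W (1 + t))) := fun _ => min_le_right _ _
      have h3 := hPadd _ _ h2 _ (hPneg _ _ (hPmono _ _ (min_le_left c (W (1 + t))) ht))
      rw [add_neg_cancel_right] at h3
      have h4 := h3 one_ne_zero
      rw [hW1] at h4
      exact absurd h4 (not_le.2 (lt_min hc hlt))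
    · exact hPadd 0 1 (fun _ => hW1.ge) t (hPmono c 0 hc.le ht) h1
  have hPconj : ∀ c g, g ≠ 0 → ∀ t ∈ P c, g * t * g⁻¹ ∈ P c := by
    intro c g hg t ht
    have h1 : g ∈ P (W g) := fun _ => le_rfl
    have h2 : g⁻¹ ∈ P (-W g) := fun _ => (hWinv g hg).ge
    have := hPmul _ _ _ (hPmul _ _ _ h1 _ ht) _ h2
    rwa [show W g + c + -W g = c by ring] at this
  have hPunit : ∀ c, ∀ s ∈ P c, ∀ u, u ≠ 0 → W u = 0 → s * u⁻¹ ∈ P c := by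
    intro c s hs u hu hWu
    have := hPmul c 0 s hs u⁻¹ fun _ => by rw [hWinv u hu, hWu, neg_zero]
    rwa [add_zero] at this
  -- K c is the image of the elements 1 + t with t of value at least c. It is normal, hence trivial
  -- or everything. If it were everything, commutators would propagate this to 2^j c, past the bound
  -- B where the image is trivial.
  let K : (c : ℝ) → 0 < c → Subgroup L := fun c hc =>
    { carrier := {l | ∃ t ∈ P c, π (1 + t) = l}
      one_mem' := ⟨0, fun h => absurd rfl h, by simp⟩
      mul_mem' := by
        rintro k l ⟨s, hs, hk⟩ ⟨t, ht, hl⟩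
        refine ⟨s + t + s * t, hPadd c _ (hPadd c _ hs _ ht) _
          (hPmono (c + c) c (by linarith) (hPmul c c s hs t ht)), ?_⟩
        rw [WithZero.coe_mul, ← hk, ← hl, ← map_mul]
        congr 1; noncomm_ring
      inv_mem' := by
        rintro l ⟨t, ht, hl⟩
        obtain ⟨h0, h1⟩ := hunit c hc t ht
        refine ⟨-(t * (1 + t)⁻¹), hPneg c _ (hPunit c t ht _ h0 h1), ?_⟩
        rw [WithZero.coe_inv, ← hl, ← map_inv₀]
        congr 1
        rw [← sub_eq_add_neg, sub_eq_iff_eq_add, ← one_add_mul, mul_inv_cancel₀ h0] }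
  have hKnormal : ∀ c hc, (K c hc).Normal := by
    refine fun c hc => ⟨fun l hl k => ?_⟩
    obtain ⟨t, ht, hl⟩ := hl
    obtain ⟨g, hg⟩ := hsurj k
    have hg0 : g ≠ 0 := ne_zero_of_map_ne_zero (π := π) (by rw [hg]; exact WithZero.coe_ne_zero)
    refine ⟨g * t * g⁻¹, hPconj c g hg0 t ht, ?_⟩
    rw [WithZero.coe_mul, WithZero.coe_mul, WithZero.coe_inv, ← hg, ← hl, ← map_inv₀, ← map_mul,
      ← map_mul]
    congr 1
    rw [mul_add, add_mul, mul_one, mul_inv_cancel₀ hg0]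
  have hKcomm : ∀ c hc, K c hc = ⊤ → K (c + c) (add_pos hc hc) = ⊤ := by
    intro c hc htop
    refine ((hKnormal _ (add_pos hc hc)).eq_bot_or_eq_top).resolve_left fun hbot => hna ?_
    intro k l
    have hk : k ∈ K c hc := htop ▸ Subgroup.mem_top k
    have hl : l ∈ K c hc := htop ▸ Subgroup.mem_top l
    obtain ⟨s, hs, hk⟩ := hk
    obtain ⟨t, ht, hl⟩ := hl
    obtain ⟨hs0, hs1⟩ := hunit c hc s hs
    obtain ⟨ht0, ht1⟩ := hunit c hc t ht
    have hts0 : (1 + t) * (1 + s) ≠ 0 := mul_ne_zero ht0 hs0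
    -- From (1 + s)(1 + t) - (1 + t)(1 + s) = st - ts, which has value at least 2c.
    have hmem : k * l * (l * k)⁻¹ ∈ K (c + c) (add_pos hc hc) := by
      refine ⟨(s * t - t * s) * ((1 + t) * (1 + s))⁻¹, hPunit _ _ ?_ _ hts0 ?_, ?_⟩
      · rw [sub_eq_add_neg]
        exact hPadd _ _ (hPmul _ _ _ hs _ ht) _ (hPneg _ _ (hPmul _ _ _ ht _ hs))
      · rw [hWmul _ _ ht0 hs0, hs1, ht1, add_zero]
      · rw [WithZero.coe_mul, WithZero.coe_inv, WithZero.coe_mul, WithZero.coe_mul, ← hk, ← hl,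
          ← map_mul, ← map_mul, ← map_inv₀, ← map_mul]
        congr 1
        rw [eq_mul_inv_iff_mul_eq₀ hts0, add_mul, inv_mul_cancel_right₀ hts0]
        noncomm_ring
    rw [hbot, Subgroup.mem_bot, mul_inv_eq_one] at hmem
    exact hmem
  have hKbot : ∀ c hc, K c hc = ⊥ := by
    intro c hc
    refine ((hKnormal c hc).eq_bot_or_eq_top).resolve_right fun htop => ?_
    have hpow : ∀ j : ℕ, ∃ h, K (2 ^ j * c) h = ⊤ := by
      intro j
      induction j with
      | zero => exact ⟨by simpa using hc, by simpa using htop⟩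
      | succ j ih =>
        obtain ⟨h, hj⟩ := ih
        have := hKcomm _ h hj
        have e : 2 ^ (j + 1) * c = 2 ^ j * c + 2 ^ j * c := by ring
        rw [e]
        exact ⟨add_pos h h, this⟩
    obtain ⟨j, hj⟩ := pow_unbounded_of_one_lt (B / c) (one_lt_two)
    rw [div_lt_iff₀ hc] at hj
    obtain ⟨h, hKj⟩ := hpow j
    apply hna
    have hall : ∀ l : L, l = 1 := by
      intro l
      have hl : l ∈ K (2 ^ j * c) h := hKj ▸ Subgroup.mem_top l
      obtain ⟨t, ht, hl⟩ := hl
      have h1 : π (1 + t) = 1 := by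
        by_cases ht0 : t = 0
        · rw [ht0, add_zero, map_one]
        · exact hWB t ht0 (hj.trans_le (ht ht0))
      rw [h1] at hl
      exact_mod_cast hl.symm
    intro a b
    rw [hall a, hall b]
  let O : Subring D :=
    { carrier := P 0
      zero_mem' := fun h => absurd rfl h
      one_mem' := fun _ => hW1.ge
      add_mem' := fun {s t} hs ht => hPadd 0 s hs t ht
      neg_mem' := fun {t} ht => hPneg 0 t ht
      mul_mem' := fun {s t} hs ht => by
        have := hPmul 0 0 s hs t ht
        rwa [add_zero] at this }
  refine ⟨O, ⟨fun t => ?_, fun g hg r hr => hPconj 0 g hg r hr, fun t _ hti => ?_⟩,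
    fun htop => ?_, fun t => Iff.rfl⟩
  · by_cases ht : t = 0
    · exact Or.inl fun h => absurd ht h
    · rcases le_total 0 (W t) with h | h
      · exact Or.inl fun _ => h
      · exact Or.inr fun _ => by rw [hWinv t ht]; linarith
  · have ht0 : t ≠ 0 := by
      rintro rfl; rw [inv_zero] at hti; exact hti O.zero_mem
    have hpos : 0 < W t := by
      by_contra! hle
      exact hti fun _ => by rw [hWinv t ht0]; linarith
    have h0 : π (1 + t) ≠ 0 := by
      rw [Ne, map_eq_zero]; exact (hunit _ hpos t fun _ => le_rfl).1
    obtain ⟨l, hl⟩ := WithZero.ne_zero_iff_exists.1 h0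
    have hmem : l ∈ K (W t) hpos := ⟨t, fun _ => le_rfl, hl.symm⟩
    rw [hKbot _ hpos, Subgroup.mem_bot] at hmem
    rw [← hl, hmem, WithZero.coe_one]
  · obtain ⟨t, ht, htn⟩ := hWneg
    have : t ∈ O := htop ▸ Subring.mem_top t
    exact absurd (this ht) (not_le.2 htn)

end Nilpotent

/-- The hypothesis bounds the dimension over the center, so a finite center would make `D` finite.
-/
lemma infinite_center_of_infinite {D : Type*} [DivisionRing D] [Infinite D]
    (hbd : BoundedOverCenter D) : (Set.center D).Infinite := by
  intro hfin
  have : Finite (Subring.center D) := hfin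
  obtain ⟨d, hd⟩ := hbd
  have hrank : Module.rank (Subring.center D) D ≤ d := by
    refine rank_le fun s hs => ?_
    by_contra! hlt
    obtain ⟨f⟩ : Nonempty (Fin (d + 1) ↪ s) := by
      refine Function.Embedding.nonempty_of_card_le ?_
      simpa using hlt
    have hli := hs.comp f f.injective
    obtain ⟨c, hc, hc0, hsum⟩ := hd fun i => (f i : D)
    rw [Fintype.linearIndependent_iff] at hli
    apply hc0
    funext i
    have := hli (fun i => ⟨c i, hc i⟩) (by simpa [Subring.smul_def] using hsum) i
    exact congrArg Subtype.val this
  have : Module.Finite (Subring.center D) D :=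
    Module.rank_lt_aleph0_iff.1 (hrank.trans_lt (Cardinal.natCast_lt_aleph0))
  have := Module.finite_of_finite (Subring.center D) (M := D)
  exact not_finite D

/-! ### Far pairs force an invariant valuation ring -/

section FarPair

/-- A pair of elements, not simultaneously centralized by a nontrivial element, such that either
no path of length four in the commuting graph joins them, or no path of length three joins one of
them to their left quotient. -/
def HasFarPair (L : Type*) [Group L] : Prop :=
  ∃ x y : L, x ≠ 1 ∧ y ≠ 1 ∧ (∀ z, Commute x z → Commute z y → z = 1) ∧
    ((∀ u v w : L, u ≠ 1 → v ≠ 1 → w ≠ 1 →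
        Commute x u → Commute u v → Commute v w → Commute w y → False) ∨
      (∀ u v : L, u ≠ 1 → v ≠ 1 →
        Commute x u → Commute u v → Commute v (x⁻¹ * y) → False) ∧
      (∀ u v : L, u ≠ 1 → v ≠ 1 →
        Commute y u → Commute u v → Commute v (x⁻¹ * y) → False))

variable {D L : Type*} [DivisionRing D] [Group L] {π : D →*₀ WithZero L}

lemma commute_coe_iff {x y : L} : Commute (x : WithZero L) (y : WithZero L) ↔ Commute x y := by
  simp only [Commute, SemiconjBy]
  norm_cast

lemma HasFarPair.exists_isIncidentPair (h : HasFarPair L) (hneg : π (-1) = 1) :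
    ∃ x y, IsIncidentPair π x y := by
  obtain ⟨x, y, hx, hy, hfar, h⟩ := h
  have hlift : ∀ z : WithZero L, z ≠ 0 → ∃ l : L, (l : WithZero L) = z := fun z hz =>
    WithZero.ne_zero_iff_exists.1 hz
  have hxy : ¬ Commute x y := fun hc => hx (hfar x (Commute.refl _) hc)
  refine ⟨x, y, WithZero.coe_ne_zero, WithZero.coe_ne_zero, by exact_mod_cast hy,
    fun z hz h1 h2 => ?_, fun a b ha hb => ?_⟩
  · obtain ⟨z, rfl⟩ := hlift z hz
    rw [commute_coe_iff] at h1 h2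
    exact_mod_cast hfar z h1 h2
  · have hxy' : ¬ Commute (x : WithZero L) (y : WithZero L) := by rwa [commute_coe_iff]
    rcases h with h | ⟨h1, h2⟩
    · refine shiftSet_incident_of_four hneg hxy' (by exact_mod_cast hx) (by exact_mod_cast hy)
        (fun u v w hu hu1 hv hv1 hw hw1 c1 c2 c3 c4 => ?_) ha hb
      obtain ⟨u, rfl⟩ := hlift u hu
      obtain ⟨v, rfl⟩ := hlift v hv
      obtain ⟨w, rfl⟩ := hlift w hw
      rw [commute_coe_iff] at c1 c2 c3 c4
      exact h u v w (by exact_mod_cast hu1) (by exact_mod_cast hv1) (by exact_mod_cast hw1)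
        c1 c2 c3 c4
    · refine shiftSet_incident_of_three hneg hxy' (by exact_mod_cast hx) (by exact_mod_cast hy)
        (fun u v hu hu1 hv hv1 c1 c2 c3 => ?_) (fun u v hu hu1 hv hv1 c1 c2 c3 => ?_) ha hb
      all_goals
        obtain ⟨u, rfl⟩ := hlift u hu
        obtain ⟨v, rfl⟩ := hlift v hv
        rw [← WithZero.coe_inv, ← WithZero.coe_mul, commute_coe_iff] at c3
        rw [commute_coe_iff] at c1 c2
      · exact h1 u v (by exact_mod_cast hu1) (by exact_mod_cast hv1) c1 c2 c3
      · exact h2 u v (by exact_mod_cast hu1) (by exact_mod_cast hv1) c1 c2 c3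

lemma map_eq_one_of_mem_center [IsSimpleGroup L] (hsurj : Function.Surjective π)
    (hna : ¬ ∀ a b : L, a * b = b * a) {c : D} (hc : c ∈ Set.center D) (hc0 : c ≠ 0) :
    π c = 1 := by
  have h0 : π c ≠ 0 := by rwa [Ne, map_eq_zero]
  obtain ⟨l, hl⟩ := WithZero.ne_zero_iff_exists.1 h0
  have hlc : l ∈ Subgroup.center L := by
    rw [Subgroup.mem_center_iff]
    intro k
    obtain ⟨a, ha⟩ := hsurj k
    have := congrArg π (commute_of_mem_center hc a)
    rw [map_mul, map_mul, ← hl, ha] at this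
    exact_mod_cast this.symm
  have hbot : Subgroup.center L = ⊥ := by
    refine (IsSimpleGroup.eq_bot_or_eq_top_of_normal _ inferInstance).resolve_right fun htop => ?_
    refine hna fun a b => ?_
    have : b ∈ Subgroup.center L := htop ▸ Subgroup.mem_top b
    exact Subgroup.mem_center_iff.1 this a
  rw [hbot, Subgroup.mem_bot] at hlc
  rw [← hl, hlc, WithZero.coe_one]

end FarPair

section Automorphism

variable {D H : Type*} [DivisionRing D] [GroupWithZero H] {π : D →*₀ H}

lemma shiftSet_subset_iff_of_equiv (σ : D ≃+* D) (hσ : ∀ t, π (σ t) = π t) {a b : D} :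
    shiftSet π (σ a) ⊆ shiftSet π (σ b) ↔ shiftSet π a ⊆ shiftSet π b := by
  have key : ∀ a n, σ n ∈ shiftSet π (σ a) ↔ n ∈ shiftSet π a := fun a n => by
    simp [shiftSet, ← map_add, hσ]
  constructor
  · intro h n hn
    exact (key b n).1 (h ((key a n).2 hn))
  · intro h n hn
    obtain ⟨m, rfl⟩ := σ.surjective n
    exact (key b m).2 (h ((key a m).1 hn))

/-- The cone is defined from π, x and y alone, so automorphisms preserving π preserve it. -/
lemma map_mem_closure_incidenceCone (σ : D ≃+* D) (hσ : ∀ t, π (σ t) = π t) (x y : H) {r : D}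
    (hr : r ∈ Subring.closure (incidenceCone π x y)) :
    σ r ∈ Subring.closure (incidenceCone π x y) := by
  induction hr using Subring.closure_induction with
  | mem v hv =>
    refine Subring.subset_closure ⟨by rw [hσ, hv.1], fun a b ha hb hab => ?_⟩
    obtain ⟨a, rfl⟩ := σ.surjective a
    obtain ⟨b, rfl⟩ := σ.surjective b
    rw [hσ] at ha hb
    rw [shiftSet_subset_iff_of_equiv σ hσ] at hab
    rw [← map_mul, shiftSet_subset_iff_of_equiv σ hσ]
    exact hv.2 a b ha hb hab
  | zero => rw [map_zero]; exact zero_mem _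
  | one => rw [map_one]; exact one_mem _
  | add s t _ _ hs ht => rw [map_add]; exact add_mem hs ht
  | neg s _ hs => rw [map_neg]; exact neg_mem hs
  | mul s t _ _ hs ht => rw [map_mul]; exact mul_mem hs ht

end Automorphism

/-- A finite nonabelian simple quotient with a far pair forces a nontrivial invariant valuation
ring. -/
theorem HasFarPair.exists_invariantValuationRing {D L : Type*} [DivisionRing D] [Group L]
    [Finite L] [IsSimpleGroup L] (h : HasFarPair L) (hna : ¬ ∀ a b : L, a * b = b * a)
    (π : D →*₀ WithZero L) (hsurj : Function.Surjective π) (hbd : BoundedOverCenter D) :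
    ∃ O : Subring D, IsInvariantValuationRing π O ∧ O ≠ ⊤ ∧
      ∀ σ : D ≃+* D, (∀ t, π (σ t) = π t) → ∀ t ∈ O, σ t ∈ O := by
  have : Finite (WithZero L) := inferInstanceAs (Finite (Option L))
  have hcen : ∀ c ∈ Set.center D, c ≠ 0 → π c = 1 := fun c hc hc0 =>
    map_eq_one_of_mem_center hsurj hna hc hc0
  have hneg : π (-1) = 1 := hcen _ ((Subring.center D).neg_mem (Subring.center D).one_mem)
    (by simp)
  have : Infinite D := by
    by_contra hfin
    rw [not_infinite_iff_finite] at hfin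
    apply hna
    intro a b
    obtain ⟨s, hs⟩ := hsurj a
    obtain ⟨t, ht⟩ := hsurj b
    have := congrArg π (littleWedderburn D |>.mul_comm s t)
    rw [map_mul, map_mul, hs, ht] at this
    exact_mod_cast this
  have hsub := exists_eq_sub_of_map_eq_one π hsurj hcen (infinite_center_of_infinite hbd)
  obtain ⟨x, y, hxy⟩ := h.exists_isIncidentPair hneg
  obtain ⟨k, hk, hk1⟩ := hxy.exists_map_one_add_mul hneg hsub hsurj
  have hR := hxy.isCone.isKernelSubring hcen hbd hsub hk hk1
  obtain ⟨e, he⟩ := hR.exists_isScale hcen hsurj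
  have hσR : ∀ σ : D ≃+* D, (∀ t, π (σ t) = π t) →
      ∀ r ∈ Subring.closure (incidenceCone π x y),
        σ r ∈ Subring.closure (incidenceCone π x y) := fun σ hσ r hr =>
    map_mem_closure_incidenceCone σ hσ x y hr
  have hσsymm : ∀ σ : D ≃+* D, (∀ t, π (σ t) = π t) → ∀ t, π (σ.symm t) = π t := fun σ hσ t => by
    rw [← hσ, σ.apply_symm_apply]
  generalize Subring.closure (incidenceCone π x y) = R at hR he hσR
  by_cases hall : ∀ t, ∃ k : ℕ, e ^ k * t ∈ R
  · obtain ⟨W, B, hWmul, hWone, hWB, hWneg, hWiff⟩ := he.exists_real_valuation hsurj hR hall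
    obtain ⟨O, hO, htop, hOW⟩ :=
      exists_invariantValuationRing_of_real_valuation hsurj hna W B hWmul hWone hWB hWneg
    refine ⟨O, hO, htop, fun σ hσ t ht => ?_⟩
    rw [hOW] at ht ⊢
    intro hσt
    have ht0 : t ≠ 0 := by rintro rfl; exact hσt (map_zero σ)
    obtain ⟨j, hj⟩ := (hWiff t ht0).1 (ht ht0)
    -- Since σ may move e, σ(t) is power bounded relative to σ(e)^j; a power of e absorbs the
    -- inverse of that factor.
    obtain ⟨l, hl⟩ := hall (σ e ^ j)⁻¹
    refine (hWiff _ hσt).2 ⟨l, fun i => ?_⟩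
    have := R.mul_mem hl (hσR σ hσ _ (hj i))
    have hσe : σ e ^ j ≠ 0 := pow_ne_zero _ (by simpa using he.ne_zero)
    rwa [map_mul, map_pow, map_pow, mul_assoc, inv_mul_cancel_left₀ hσe] at this
  · push Not at hall
    obtain ⟨t, ht⟩ := hall
    obtain ⟨O, hO, htop, hOσ⟩ := hR.exists_invariantValuationRing_of_ne_top hcen he ht
    exact ⟨O, hO, htop, fun σ hσ => hOσ σ hσ (hσR σ hσ) (hσR σ.symm (hσsymm σ hσ))⟩

/-! ### Residue division ring and value group -/

namespace IsInvariantValuationRing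

variable {D H : Type*} [DivisionRing D] [GroupWithZero H] {π : D →*₀ H} {O : Subring D}

/-- The ideal of nonunits. -/
def nonunitsIdeal (hO : IsInvariantValuationRing π O) : Ideal O where
  carrier := {t | (t : D) = 0 ∨ (t : D)⁻¹ ∉ O}
  zero_mem' := Or.inl rfl
  add_mem' := by
    have key : ∀ s t : D, s ∈ O → t ∈ O → s ≠ 0 → s⁻¹ * t ∈ O → (s + t)⁻¹ ∈ O → s + t ≠ 0 →
        s⁻¹ ∈ O := by
      intro s t _ _ hs h1 h2 h3
      have e : s + t = s * (1 + s⁻¹ * t) := by rw [mul_add, mul_one, mul_inv_cancel_left₀ hs]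
      have h4 : 1 + s⁻¹ * t ≠ 0 := by rw [e] at h3; exact right_ne_zero_of_mul h3
      have := O.mul_mem (O.add_mem O.one_mem h1) h2
      rwa [e, mul_inv_rev, mul_inv_cancel_left₀ h4] at this
    rintro ⟨s, hs⟩ ⟨t, ht⟩ hs' ht'
    simp only [Set.mem_ofPred_eq, Subring.coe_add] at hs' ht' ⊢
    by_cases hs0 : s = 0
    · rw [hs0, zero_add]; exact ht'
    by_cases ht0 : t = 0
    · rw [ht0, add_zero]; exact hs'
    by_contra! hcon
    rcases hO.total (s⁻¹ * t) with h | h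
    · exact hs'.resolve_left hs0 (key s t hs ht hs0 h hcon.2 hcon.1)
    · rw [mul_inv_rev, inv_inv] at h
      exact ht'.resolve_left ht0 (key t s ht hs ht0 h (by rw [add_comm]; exact hcon.2)
        (by rw [add_comm]; exact hcon.1))
  smul_mem' := by
    rintro ⟨r, hr⟩ ⟨t, ht⟩ ht'
    simp only [Set.mem_ofPred_eq, smul_eq_mul, Subring.coe_mul] at ht' ⊢
    by_contra! hcon
    have hr0 := left_ne_zero_of_mul hcon.1
    refine ht'.elim (right_ne_zero_of_mul hcon.1) fun h => h ?_
    have := O.mul_mem hcon.2 hr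
    rwa [mul_inv_rev, inv_mul_cancel_right₀ hr0] at this

lemma mem_nonunitsIdeal (hO : IsInvariantValuationRing π O) {t : O} :
    t ∈ hO.nonunitsIdeal ↔ (t : D) = 0 ∨ (t : D)⁻¹ ∉ O := Iff.rfl

lemma isTwoSided_nonunitsIdeal (hO : IsInvariantValuationRing π O) :
    hO.nonunitsIdeal.IsTwoSided := by
  refine ⟨fun {t} r ht => ?_⟩
  rw [mem_nonunitsIdeal, Subring.coe_mul] at *
  by_contra! hcon
  have hr0 := right_ne_zero_of_mul hcon.1
  refine ht.elim (left_ne_zero_of_mul hcon.1) fun h => h ?_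
  have := O.mul_mem r.2 hcon.2
  rwa [mul_inv_rev, mul_inv_cancel_left₀ hr0] at this

/-- The residue division ring. -/
lemma exists_residue.{u} {D : Type u} [DivisionRing D] {π : D →*₀ H} {O : Subring D}
    (hO : IsInvariantValuationRing π O) :
    ∃ (E : Type u) (_ : DivisionRing E) (q : O →+* E), Function.Surjective q ∧
      ∀ t : O, q t = 0 ↔ (t : D) = 0 ∨ (t : D)⁻¹ ∉ O := by
  have := hO.isTwoSided_nonunitsIdeal
  have hq : ∀ t : O, Ideal.Quotient.mk hO.nonunitsIdeal t = 0 ↔ (t : D) = 0 ∨ (t : D)⁻¹ ∉ O :=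
    fun t => Ideal.Quotient.eq_zero_iff_mem
  have hnt : Nontrivial (O ⧸ hO.nonunitsIdeal) := by
    refine ⟨⟨Ideal.Quotient.mk hO.nonunitsIdeal 1, 0, fun h => ?_⟩⟩
    rw [hq] at h
    simp at h
  have hunit : ∀ a : O ⧸ hO.nonunitsIdeal, IsUnit a ∨ a = 0 := by
    intro a
    obtain ⟨t, rfl⟩ := Ideal.Quotient.mk_surjective a
    by_cases h : Ideal.Quotient.mk hO.nonunitsIdeal t = 0
    · exact Or.inr h
    · left
      rw [hq] at h
      push Not at h
      have h1 : t * ⟨(t : D)⁻¹, h.2⟩ = 1 := Subtype.ext (mul_inv_cancel₀ h.1)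
      have h2 : (⟨(t : D)⁻¹, h.2⟩ : O) * t = 1 := Subtype.ext (inv_mul_cancel₀ h.1)
      exact ((⟨t, ⟨(t : D)⁻¹, h.2⟩, h1, h2⟩ : Oˣ).isUnit).map (Ideal.Quotient.mk _)
  exact ⟨O ⧸ hO.nonunitsIdeal, DivisionRing.ofIsUnitOrEqZero hunit,
    Ideal.Quotient.mk hO.nonunitsIdeal, Ideal.Quotient.mk_surjective, hq⟩

/-- In a finite family some nonzero entry has least value; dividing by it makes all entries
integral. -/
lemma exists_forall_mul_inv_mem (hO : IsInvariantValuationRing π O) {ι : Type*} [Fintype ι]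
    (a : ι → D) (ha : ∃ i, a i ≠ 0) : ∃ j, a j ≠ 0 ∧ ∀ i, a i * (a j)⁻¹ ∈ O := by
  classical
  have key : ∀ s : Finset ι, (∃ i ∈ s, a i ≠ 0) →
      ∃ j ∈ s, a j ≠ 0 ∧ ∀ i ∈ s, a i * (a j)⁻¹ ∈ O := by
    intro s
    induction s using Finset.induction_on with
    | empty => simp
    | insert i s _ ih =>
      rintro ⟨l, hl, hl0⟩
      by_cases hs : ∃ j ∈ s, a j ≠ 0
      · obtain ⟨j, hj, hj0, hjs⟩ := ih hs
        rcases hO.total (a i * (a j)⁻¹) with h | h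
        · refine ⟨j, Finset.mem_insert_of_mem hj, hj0, fun k hk => ?_⟩
          rcases Finset.mem_insert.1 hk with rfl | hk
          · exact h
          · exact hjs k hk
        · by_cases hi0 : a i = 0
          · refine ⟨j, Finset.mem_insert_of_mem hj, hj0, fun k hk => ?_⟩
            rcases Finset.mem_insert.1 hk with rfl | hk
            · rw [hi0, zero_mul]; exact O.zero_mem
            · exact hjs k hk
          · refine ⟨i, Finset.mem_insert_self _ _, hi0, fun k hk => ?_⟩
            rcases Finset.mem_insert.1 hk with rfl | hk
            · rw [mul_inv_cancel₀ hi0]; exact O.one_mem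
            · have := O.mul_mem (hjs k hk) h
              rwa [mul_inv_rev, inv_inv, mul_assoc, inv_mul_cancel_left₀ hj0] at this
      · push Not at hs
        have hi0 : a i ≠ 0 := by
          rcases Finset.mem_insert.1 hl with rfl | hl
          · exact hl0
          · exact absurd (hs l hl) hl0
        refine ⟨i, Finset.mem_insert_self _ _, hi0, fun k hk => ?_⟩
        rcases Finset.mem_insert.1 hk with rfl | hk
        · rw [mul_inv_cancel₀ hi0]; exact O.one_mem
        · rw [hs k hk, zero_mul]; exact O.zero_mem
  obtain ⟨i, hi⟩ := ha
  obtain ⟨j, -, hj0, hj⟩ := key Finset.univ ⟨i, Finset.mem_univ _, hi⟩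
  exact ⟨j, hj0, fun i => hj i (Finset.mem_univ _)⟩

/-- A dependence between lifts, divided by its coefficient of least value, has integral central
coefficients, one of them 1, and so survives reduction. -/
lemma boundedOverCenter_residue (hO : IsInvariantValuationRing π O) (hbd : BoundedOverCenter D)
    {E : Type*} [DivisionRing E] {q : O →+* E} (hq : Function.Surjective q) :
    BoundedOverCenter E := by
  obtain ⟨d, hd⟩ := hbd
  refine ⟨d, fun t => ?_⟩
  choose s hs using fun i => hq (t i)
  obtain ⟨c, hc, hc0, hsum⟩ := hd fun i => (s i : D)
  obtain ⟨j, hj0, hj⟩ := hO.exists_forall_mul_inv_mem c (by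
    by_contra! h; exact hc0 (funext h))
  have hcen : ∀ i, c i * (c j)⁻¹ ∈ Set.center D := fun i =>
    Set.mul_mem_center (hc i) (inv_mem_center (hc j))
  refine ⟨fun i => q ⟨_, hj i⟩, fun i => ?_, fun h => ?_, ?_⟩
  · rw [Semigroup.mem_center_iff]
    intro x
    obtain ⟨y, rfl⟩ := hq x
    rw [← map_mul, ← map_mul]
    congr 1
    exact Subtype.ext (commute_of_mem_center (hcen i) (y : D)).symm
  · have h1 := congrFun h j
    have h2 : (⟨_, hj j⟩ : O) = 1 := Subtype.ext (mul_inv_cancel₀ hj0)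
    rw [h2, map_one] at h1
    exact one_ne_zero h1
  · have h1 : ∑ i, (⟨_, hj i⟩ : O) * s i = 0 := by
      apply Subtype.ext
      rw [AddSubmonoidClass.coe_finsetSum]
      have : (c j)⁻¹ * ∑ i, c i * (s i : D) = 0 := by rw [hsum, mul_zero]
      rw [Finset.mul_sum] at this
      refine Eq.trans (Finset.sum_congr rfl fun i _ => ?_) this
      rw [← mul_assoc, ← commute_of_mem_center (hc i)]
      rfl
    have h2 := congrArg q h1
    rw [map_sum, map_zero] at h2
    rw [← h2]
    refine Finset.sum_congr rfl fun i _ => ?_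
    rw [map_mul, hs]

/-- Some power of every element is a central multiple of a unit. -/
lemma exists_pow_mul_mem (hO : IsInvariantValuationRing π O) (hbd : BoundedOverCenter D) {h : D}
    (hh : h ≠ 0) : ∃ (k : ℕ) (f : D), f ∈ Set.center D ∧ f ≠ 0 ∧ f * h ^ (k + 1) ∈ O ∧
      (f * h ^ (k + 1))⁻¹ ∈ O := by
  obtain ⟨d, hd⟩ := hbd
  obtain ⟨c, hc, hc0, hsum⟩ := hd fun i => h ^ (i : ℕ)
  have hne : ∀ i, c i * h ^ (i : ℕ) = 0 ↔ c i = 0 := fun i => by simp [hh]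
  obtain ⟨j, hj0, hj⟩ := hO.exists_forall_mul_inv_mem (fun i => c i * h ^ (i : ℕ)) (by
    by_contra! h; exact hc0 (funext fun i => (hne i).1 (h i)))
  -- Least value must be attained twice: otherwise, after division by the dominant term, a sum of
  -- nonunits would equal -1. The quotient of the two terms is the required central multiple of a
  -- power of h.
  obtain ⟨i, hij, hi0, hi⟩ : ∃ i, i ≠ j ∧ c i * h ^ (i : ℕ) ≠ 0 ∧
      (c i * h ^ (i : ℕ) * (c j * h ^ (j : ℕ))⁻¹)⁻¹ ∈ O := by
    classical
    by_contra! hcon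
    have h1 : (∑ i, c i * h ^ (i : ℕ)) * (c j * h ^ (j : ℕ))⁻¹ = 0 := by rw [hsum, zero_mul]
    rw [Finset.sum_mul, ← Finset.add_sum_erase _ _ (Finset.mem_univ j), mul_inv_cancel₀ hj0] at h1
    have h2 : ∑ i ∈ Finset.univ.erase j, (⟨_, hj i⟩ : O) ∈ hO.nonunitsIdeal := by
      refine Ideal.sum_mem _ fun i hi => ?_
      rw [mem_nonunitsIdeal]
      by_cases hi0 : c i * h ^ (i : ℕ) = 0
      · left; simp only [hi0, zero_mul]
      · exact Or.inr (hcon i (Finset.ne_of_mem_erase hi) hi0)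
    have h3 : ∑ i ∈ Finset.univ.erase j, (⟨_, hj i⟩ : O) = -1 := by
      apply Subtype.ext
      rw [AddSubmonoidClass.coe_finsetSum, Subring.coe_neg, Subring.coe_one]
      exact eq_neg_of_add_eq_zero_right h1
    rw [h3, mem_nonunitsIdeal] at h2
    simp at h2
  have key : ∀ i j : Fin (d + 1), j < i → c i * h ^ (i : ℕ) ≠ 0 → c j * h ^ (j : ℕ) ≠ 0 →
      ∃ (k : ℕ) (f : D), f ∈ Set.center D ∧ f ≠ 0 ∧
        c i * h ^ (i : ℕ) * (c j * h ^ (j : ℕ))⁻¹ = f * h ^ (k + 1) := by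
    intro i j hji hi hj
    have hci : c i ≠ 0 := left_ne_zero_of_mul hi
    have hcj : c j ≠ 0 := left_ne_zero_of_mul hj
    refine ⟨i - j - 1, c i * (c j)⁻¹, Set.mul_mem_center (hc i) (inv_mem_center (hc j)),
      mul_ne_zero hci (inv_ne_zero hcj), ?_⟩
    have e : (i : ℕ) = (i - j - 1 + 1) + j := by
      have : (j : ℕ) < i := hji
      omega
    conv_lhs => rw [e, pow_add]
    rw [mul_inv_rev, mul_assoc (c i), mul_assoc (h ^ (_ + 1)),
      mul_inv_cancel_left₀ (pow_ne_zero _ hh), ← commute_of_mem_center (inv_mem_center (hc j)),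
      mul_assoc]
  rcases lt_or_gt_of_ne hij with hlt | hlt
  · obtain ⟨k, f, hf, hf0, he⟩ := key j i hlt hj0 hi0
    refine ⟨k, f, hf, hf0, ?_, ?_⟩
    · rw [← he]; rwa [mul_inv_rev, inv_inv] at hi
    · rw [← he, mul_inv_rev, inv_inv]; exact hj i
  · obtain ⟨k, f, hf, hf0, he⟩ := key i j hlt hi0 hj0
    exact ⟨k, f, hf, hf0, by rw [← he]; exact hj i, by rw [← he]; exact hi⟩

/-- The value group is commutative. -/
lemma commutator_mem (hO : IsInvariantValuationRing π O) (hbd : BoundedOverCenter D) {g h : D}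
    (hg : g ≠ 0) (hh : h ≠ 0) : g * h * g⁻¹ * h⁻¹ ∈ O := by
  have key : ∀ g h : D, g ≠ 0 → h ≠ 0 → g * h * g⁻¹ * h⁻¹ ∈ O → (g * h * g⁻¹ * h⁻¹)⁻¹ ∈ O := by
    intro g h hg hh hcO
    by_contra hci
    set c := g * h * g⁻¹ * h⁻¹ with hc
    have hc0 : c ≠ 0 := by simp [hc, hg, hh]
    have hch : c * h = g * h * g⁻¹ := inv_mul_cancel_right₀ hh _
    -- If c were a nonunit, the factors c would accumulate: (ch)^(k+1) = x h^(k+1) with x a nonunit.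
    -- But ch = ghg⁻¹, and some power of h is a unit up to a central factor, so x is also a
    -- commutator with a unit, hence a unit.
    have hpow : ∀ k : ℕ, ∃ x, x ≠ 0 ∧ x⁻¹ ∉ O ∧ (c * h) ^ (k + 1) = x * h ^ (k + 1) := by
      intro k
      induction k with
      | zero => exact ⟨c, hc0, hci, by simp⟩
      | succ k ih =>
        obtain ⟨x, hx0, hx, hxe⟩ := ih
        refine ⟨c * (h * x * h⁻¹), by simp [hc0, hh, hx0], fun hmem => hx ?_, ?_⟩
        · have h1 := O.mul_mem hmem hcO
          rw [mul_inv_rev, inv_mul_cancel_right₀ hc0] at h1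
          have h2 := hO.conj_mem h⁻¹ (inv_ne_zero hh) _ h1
          rwa [mul_inv_rev, mul_inv_rev, inv_inv, mul_assoc h⁻¹, mul_assoc, mul_assoc,
            inv_mul_cancel_left₀ hh, inv_mul_cancel₀ hh, mul_one] at h2
        · rw [pow_succ' (c * h), hxe, pow_succ' h (k + 1)]
          simp only [mul_assoc]
          rw [inv_mul_cancel_left₀ hh]
    obtain ⟨k, f, hf, hf0, hu, hui⟩ := hO.exists_pow_mul_mem hbd hh
    obtain ⟨x, hx0, hx, hxe⟩ := hpow k
    apply hx
    have hconj : (g * h * g⁻¹) ^ (k + 1) = g * h ^ (k + 1) * g⁻¹ := by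
      simpa using Units.conj_pow (Units.mk0 g hg) h (k + 1)
    rw [hch, hconj] at hxe
    have e : x = g * (f * h ^ (k + 1)) * g⁻¹ * (f * h ^ (k + 1))⁻¹ := by
      rw [eq_mul_inv_iff_mul_eq₀ (mul_ne_zero hf0 (pow_ne_zero _ hh)), ← mul_assoc x,
        ← commute_of_mem_center hf x, mul_assoc f, ← hxe, ← mul_assoc g f,
        ← commute_of_mem_center hf g]
      simp only [mul_assoc]
    have h1 := O.mul_mem hu (hO.conj_mem g hg _ hui)
    generalize f * h ^ (k + 1) = u at e h1
    rw [e, mul_inv_rev, mul_inv_rev, mul_inv_rev, inv_inv, inv_inv, ← mul_assoc g]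
    exact h1
  rcases hO.total (g * h * g⁻¹ * h⁻¹) with h1 | h1
  · exact h1
  · have e : (g * h * g⁻¹ * h⁻¹)⁻¹ = h * g * h⁻¹ * g⁻¹ := by
      simp only [mul_inv_rev, inv_inv, mul_assoc]
    have h2 := key h g hh hg (e ▸ h1)
    rwa [← e, inv_inv] at h2

end IsInvariantValuationRing

namespace IsInvariantValuationRing

section Residue

variable {D H E : Type*} [DivisionRing D] [GroupWithZero H] [DivisionRing E] {π : D →*₀ H}
  {O : Subring D} {q : O →+* E}

/-- Here s⁻¹t is 1 plus a nonunit, hence in the kernel of π. -/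
lemma map_unit_eq_of_residue_eq (hO : IsInvariantValuationRing π O)
    (hker : ∀ t : O, q t = 0 ↔ (t : D) = 0 ∨ (t : D)⁻¹ ∉ O) {s t : O} (hst : q s = q t)
    (hs : q s ≠ 0) : π (s : D) = π (t : D) := by
  have hs' := hs
  rw [Ne, hker] at hs
  push Not at hs
  obtain ⟨hs0, hsi⟩ := hs
  have h1 : q (⟨(s : D)⁻¹, hsi⟩ * t - 1) = 0 := by
    rw [map_sub, map_mul, ← hst, ← map_mul, map_one, sub_eq_zero]
    have : (⟨(s : D)⁻¹, hsi⟩ : O) * s = 1 := Subtype.ext (inv_mul_cancel₀ hs0)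
    rw [this, map_one]
  rw [hker] at h1
  have e : (1 : D) + ((⟨(s : D)⁻¹, hsi⟩ * t - 1 : O) : D) = (s : D)⁻¹ * t := by
    rw [AddSubgroupClass.coe_sub, Subring.coe_one, Subring.coe_mul, add_sub_cancel]
  have h2 : π ((s : D)⁻¹ * t) = 1 := by
    rw [← e]
    rcases h1 with h1 | h1
    · rw [h1, add_zero, map_one]
    · exact hO.map_one_add _ (Subtype.property _) h1
  rw [map_mul, map_inv₀] at h2
  exact ((inv_mul_eq_one₀ (by rwa [Ne, map_eq_zero])).1 h2)

/-- The map induced by `π` on the residue division ring. -/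
lemma exists_residue_hom (hO : IsInvariantValuationRing π O) (hq : Function.Surjective q)
    (hker : ∀ t : O, q t = 0 ↔ (t : D) = 0 ∨ (t : D)⁻¹ ∉ O) :
    ∃ πE : E →*₀ H, ∀ t : O, q t ≠ 0 → πE (q t) = π (t : D) := by
  classical
  choose s hs using hq
  have hkey : ∀ t : O, q t ≠ 0 → π (s (q t) : D) = π (t : D) := fun t ht =>
    hO.map_unit_eq_of_residue_eq hker (hs _) (by rwa [hs])
  refine ⟨{ toFun := fun x => if x = 0 then 0 else π (s x : D)
            map_zero' := if_pos rfl
            map_one' := ?_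
            map_mul' := fun x y => ?_ }, fun t ht => ?_⟩
  · have h1 : q 1 ≠ 0 := by rw [map_one]; exact one_ne_zero
    have := hkey 1 h1
    rw [map_one] at this
    rw [if_neg one_ne_zero, this, Subring.coe_one, map_one]
  · by_cases hx : x = 0
    · simp [hx]
    by_cases hy : y = 0
    · simp [hy]
    have hxy := mul_ne_zero hx hy
    rw [if_neg hx, if_neg hy, if_neg hxy, ← map_mul, ← Subring.coe_mul]
    have := hkey (s x * s y) (by rwa [map_mul, hs, hs])
    rwa [map_mul, hs, hs] at this
  · show (if q t = 0 then 0 else π (s (q t) : D)) = _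
    rw [if_neg ht, hkey t ht]

/-- Conjugation induces automorphisms of the residue division ring. -/
lemma exists_conj_equiv (hO : IsInvariantValuationRing π O) (hq : Function.Surjective q)
    (hker : ∀ t : O, q t = 0 ↔ (t : D) = 0 ∨ (t : D)⁻¹ ∉ O) {g : D} (hg : g ≠ 0) :
    ∃ σ : E ≃+* E, ∀ t t' : O, (t' : D) = g * t * g⁻¹ → σ (q t) = q t' := by
  let γ : O →+* O :=
    { toFun := fun t => ⟨g * t * g⁻¹, hO.conj_mem g hg _ t.2⟩
      map_zero' := Subtype.ext (by simp)
      map_one' := Subtype.ext (by simp [hg])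
      map_add' := fun s t => Subtype.ext (by simp [mul_add, add_mul])
      map_mul' := fun s t => Subtype.ext (by
        simp only [Subring.coe_mul, mul_assoc]
        rw [inv_mul_cancel_left₀ hg]) }
  have hle : RingHom.ker q ≤ RingHom.ker (q.comp γ) := by
    intro t ht
    rw [RingHom.mem_ker] at ht ⊢
    rw [RingHom.comp_apply, hker]
    rw [hker] at ht
    refine ht.imp (fun h => by simp [γ, h]) fun h hmem => h ?_
    have := hO.conj_mem g⁻¹ (inv_ne_zero hg) _ hmem
    change g⁻¹ * (g * t * g⁻¹)⁻¹ * g⁻¹⁻¹ ∈ O at this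
    rwa [mul_inv_rev, mul_inv_rev, inv_inv, inv_mul_cancel_left₀ hg,
      inv_mul_cancel_right₀ hg] at this
  let f : E →+* E := q.liftOfSurjective hq ⟨q.comp γ, hle⟩
  have hf : ∀ t, f (q t) = q (γ t) := fun t =>
    RingHom.liftOfRightInverse_comp_apply q _ (Function.rightInverse_surjInv hq) ⟨q.comp γ, hle⟩ t
  have hsurj : Function.Surjective f := by
    intro x
    obtain ⟨t, rfl⟩ := hq x
    refine ⟨q ⟨g⁻¹ * t * g⁻¹⁻¹, hO.conj_mem _ (inv_ne_zero hg) _ t.2⟩, ?_⟩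
    rw [hf]
    congr 1
    refine Subtype.ext ?_
    show g * (g⁻¹ * t * g⁻¹⁻¹) * g⁻¹ = t
    rw [inv_inv, mul_assoc g⁻¹, mul_inv_cancel_left₀ hg, mul_inv_cancel_right₀ hg]
  have hbij : Function.Bijective f := ⟨f.injective, hsurj⟩
  refine ⟨RingEquiv.ofBijective f hbij, fun t t' h => (hf t).trans ?_⟩
  congr 1
  exact Subtype.ext h.symm

end Residue

/-! ### Descent to a strictly smaller valuation ring -/

section Simple

variable {D L : Type*} [DivisionRing D] [Group L] {π : D →*₀ WithZero L} {O : Subring D}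

/-- The units of an invariant valuation ring map onto a nonabelian simple quotient. -/
lemma exists_unit_map_eq [IsSimpleGroup L] (hO : IsInvariantValuationRing π O)
    (hbd : BoundedOverCenter D) (hsurj : Function.Surjective π)
    (hna : ¬ ∀ a b : L, a * b = b * a) (l : L) :
    ∃ t, t ∈ O ∧ t⁻¹ ∈ O ∧ π t = (l : WithZero L) := by
  let K : Subgroup L :=
    { carrier := {l | ∃ t, t ∈ O ∧ t⁻¹ ∈ O ∧ π t = (l : WithZero L)}
      one_mem' := ⟨1, O.one_mem, by rw [inv_one]; exact O.one_mem, by simp⟩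
      mul_mem' := by
        rintro k l ⟨s, hs, hsi, hk⟩ ⟨t, ht, hti, hl⟩
        refine ⟨s * t, O.mul_mem hs ht, ?_, by rw [map_mul, hk, hl, WithZero.coe_mul]⟩
        rw [mul_inv_rev]; exact O.mul_mem hti hsi
      inv_mem' := by
        rintro l ⟨t, ht, hti, hl⟩
        exact ⟨t⁻¹, hti, by rwa [inv_inv], by rw [map_inv₀, hl, WithZero.coe_inv]⟩ }
  have hK : K.Normal := by
    refine ⟨fun l hl k => ?_⟩
    obtain ⟨t, ht, hti, hl⟩ := hl
    obtain ⟨g, hg⟩ := hsurj k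
    have hg0 : g ≠ 0 := ne_zero_of_map_ne_zero (π := π) (by rw [hg]; exact WithZero.coe_ne_zero)
    refine ⟨g * t * g⁻¹, hO.conj_mem g hg0 _ ht, ?_, ?_⟩
    · have := hO.conj_mem g hg0 _ hti
      rwa [mul_inv_rev, mul_inv_rev, inv_inv, ← mul_assoc]
    · rw [map_mul, map_mul, map_inv₀, hg, hl, WithZero.coe_mul, WithZero.coe_mul,
        WithZero.coe_inv]
  -- All commutators of D are units of O, so if the units had trivial image, `L` would be abelian.
  rcases hK.eq_bot_or_eq_top with hbot | htop
  · exfalso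
    apply hna
    intro a b
    obtain ⟨g, hg⟩ := hsurj a
    obtain ⟨h, hh⟩ := hsurj b
    have hg0 : g ≠ 0 := ne_zero_of_map_ne_zero (π := π) (by rw [hg]; exact WithZero.coe_ne_zero)
    have hh0 : h ≠ 0 := ne_zero_of_map_ne_zero (π := π) (by rw [hh]; exact WithZero.coe_ne_zero)
    have hmem : a * b * a⁻¹ * b⁻¹ ∈ K := by
      refine ⟨g * h * g⁻¹ * h⁻¹, hO.commutator_mem hbd hg0 hh0, ?_, ?_⟩
      · have := hO.commutator_mem hbd hh0 hg0
        simpa only [mul_inv_rev, inv_inv, mul_assoc] using this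
      · simp only [map_mul, map_inv₀, hg, hh, WithZero.coe_mul, WithZero.coe_inv]
    rw [hbot, Subgroup.mem_bot, mul_inv_eq_one, mul_inv_eq_iff_eq_mul] at hmem
    exact hmem
  · have : l ∈ K := htop ▸ Subgroup.mem_top l
    exact this

/-- An invariant valuation ring contains a strictly smaller one. -/
lemma exists_lt [Finite L] [IsSimpleGroup L] (hO : IsInvariantValuationRing π O)
    (hL : HasFarPair L) (hna : ¬ ∀ a b : L, a * b = b * a) (hbd : BoundedOverCenter D)
    (hsurj : Function.Surjective π) : ∃ O', IsInvariantValuationRing π O' ∧ O' < O := by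
  obtain ⟨E, _, q, hq, hker⟩ := hO.exists_residue
  obtain ⟨πE, hπE⟩ := hO.exists_residue_hom hq hker
  have hqunit : ∀ t : O, (t : D) ≠ 0 → (t : D)⁻¹ ∈ O → q t ≠ 0 := fun t h0 h1 h => by
    rw [hker] at h
    exact h.elim h0 fun h => h h1
  have hqinv : ∀ (t : O) (_ : (t : D) ≠ 0) (h : (t : D)⁻¹ ∈ O), q ⟨(t : D)⁻¹, h⟩ = (q t)⁻¹ := by
    intro t h0 h
    refine eq_inv_of_mul_eq_one_left ?_
    rw [← map_mul]
    have : (⟨(t : D)⁻¹, h⟩ : O) * t = 1 := Subtype.ext (inv_mul_cancel₀ h0)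
    rw [this, map_one]
  have hunits : ∀ l : L, ∃ t : O, (t : D) ≠ 0 ∧ (t : D)⁻¹ ∈ O ∧ π (t : D) = (l : WithZero L) := by
    intro l
    obtain ⟨t, ht, hti, hl⟩ := hO.exists_unit_map_eq hbd hsurj hna l
    exact ⟨⟨t, ht⟩, ne_zero_of_map_ne_zero (π := π) (by rw [hl]; exact WithZero.coe_ne_zero),
      hti, hl⟩
  have hsurjE : Function.Surjective πE := by
    intro z
    by_cases hz : z = 0
    · exact ⟨0, by rw [hz, map_zero]⟩
    obtain ⟨l, rfl⟩ := WithZero.ne_zero_iff_exists.1 hz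
    obtain ⟨t, ht0, hti, hl⟩ := hunits l
    exact ⟨q t, by rw [hπE t (hqunit t ht0 hti), hl]⟩
  obtain ⟨V, hV, hVtop, hVσ⟩ := hL.exists_invariantValuationRing hna πE hsurjE
    (hO.boundedOverCenter_residue hbd hq)
  have hmem : ∀ t : D, t ∈ (V.comap q).map O.subtype ↔ ∃ h : t ∈ O, q ⟨t, h⟩ ∈ V := by
    intro t
    simp [Subring.mem_map]
  refine ⟨(V.comap q).map O.subtype, ⟨fun t => ?_, fun g hg r hr => ?_, fun t ht hti => ?_⟩, ?_⟩
  · rw [hmem, hmem]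
    have key : ∀ t : D, t ∈ O → (∃ h : t ∈ O, q ⟨t, h⟩ ∈ V) ∨ ∃ h : t⁻¹ ∈ O, q ⟨t⁻¹, h⟩ ∈ V := by
      intro t ht
      by_cases hq0 : q ⟨t, ht⟩ = 0
      · exact Or.inl ⟨ht, hq0 ▸ V.zero_mem⟩
      · have hq1 := hq0
        rw [hker] at hq1
        push Not at hq1
        refine (hV.total (q ⟨t, ht⟩)).imp (fun h => ⟨ht, h⟩) fun h => ⟨hq1.2, ?_⟩
        rwa [hqinv ⟨t, ht⟩ hq1.1 hq1.2]
    rcases hO.total t with h | h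
    · exact key t h
    · have := key t⁻¹ h
      rw [or_comm]
      simpa only [inv_inv] using this
  · rw [hmem] at hr ⊢
    obtain ⟨hrO, hrV⟩ := hr
    refine ⟨hO.conj_mem g hg r hrO, ?_⟩
    have hπg : π g ≠ 0 := by rwa [Ne, map_eq_zero]
    obtain ⟨l, hl⟩ := WithZero.ne_zero_iff_exists.1 hπg
    -- Factor g as (gu⁻¹)u with u a unit of the same image: u acts on the residue ring by an inner
    -- automorphism, and gu⁻¹ by one that preserves `πE`. V is stable under both.
    obtain ⟨u, hu0, hui, hul⟩ := hunits l
    have hn : π (g * (u : D)⁻¹) = 1 := by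
      rw [map_mul, map_inv₀, hul, hl, mul_inv_cancel₀ hπg]
    have hn0 := ne_zero_of_map_eq_one hn
    obtain ⟨σ, hσ⟩ := hO.exists_conj_equiv hq hker hn0
    have hσπ : ∀ x, πE (σ x) = πE x := by
      intro x
      obtain ⟨t, rfl⟩ := hq x
      by_cases ht : q t = 0
      · rw [ht, map_zero]
      have h1 := hσ t ⟨_, hO.conj_mem _ hn0 _ t.2⟩ rfl
      have h2 : σ (q t) ≠ 0 := by simpa using ht
      rw [h1] at h2 ⊢
      rw [hπE _ h2, hπE _ ht]
      have hconj : ∀ n : D, π n = 1 → π (n * t * n⁻¹) = π (t : D) := fun n hn => by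
        rw [map_mul, map_mul, map_inv₀, hn, one_mul, inv_one, mul_one]
      exact hconj _ hn
    have h1 : q u * q ⟨r, hrO⟩ * (q u)⁻¹ ∈ V := hV.conj_mem _ (hqunit u hu0 hui) _ hrV
    rw [← hqinv u hu0 hui, ← map_mul, ← map_mul] at h1
    have h2 := hVσ σ hσπ _ h1
    rwa [hσ _ ⟨_, hO.conj_mem g hg r hrO⟩ ?_] at h2
    show g * r * g⁻¹ = g * (u : D)⁻¹ * (u * r * (u : D)⁻¹) * (g * (u : D)⁻¹)⁻¹
    rw [mul_inv_rev, inv_inv]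
    simp only [mul_assoc]
    rw [inv_mul_cancel_left₀ hu0, inv_mul_cancel_left₀ hu0]
  · rw [hmem] at ht hti
    obtain ⟨htO, htV⟩ := ht
    by_cases htiO : t⁻¹ ∈ O
    · have ht0 : t ≠ 0 := by
        rintro rfl
        apply hti
        refine ⟨htiO, ?_⟩
        have : (⟨(0 : D)⁻¹, htiO⟩ : O) = 0 := Subtype.ext inv_zero
        rw [this, map_zero]
        exact V.zero_mem
      have h1 : (q ⟨t, htO⟩)⁻¹ ∉ V := fun h => hti ⟨htiO, by
        rwa [hqinv ⟨t, htO⟩ ht0 htiO]⟩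
      have h2 := hV.map_one_add _ htV h1
      rw [← map_one q, ← map_add] at h2
      rwa [hπE _ (ne_zero_of_map_eq_one h2)] at h2
    · exact hO.map_one_add t htO htiO
  · rw [lt_iff_le_and_ne]
    refine ⟨fun t ht => ((hmem t).1 ht).1, fun heq => hVtop ?_⟩
    rw [eq_top_iff]
    intro x _
    obtain ⟨t, rfl⟩ := hq x
    have : (t : D) ∈ (V.comap q).map O.subtype := by rw [heq]; exact t.2
    exact ((hmem t).1 this).2

end Simple

end IsInvariantValuationRing

/-- A finite nonabelian simple group with a far pair is not a quotient of the multiplicative group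
of a division ring in which any `d + 1` elements are dependent over the center. -/
theorem not_surjective_of_hasFarPair {D L : Type*} [DivisionRing D] [Group L] [Finite L]
    [IsSimpleGroup L] (hL : HasFarPair L) (hna : ¬ ∀ a b : L, a * b = b * a)
    (hbd : BoundedOverCenter D) (π : D →*₀ WithZero L) : ¬ Function.Surjective π := by
  intro hsurj
  -- In the dual order a maximal element is a minimal ring; the empty chain is bounded by its
  -- infimum, the whole of D.
  obtain ⟨O, hO⟩ := @zorn_le₀ (Subring D)ᵒᵈ _ {O | IsInvariantValuationRing π (OrderDual.ofDual O)}
    fun c hc hchain => ⟨OrderDual.toDual (sInf (OrderDual.toDual ⁻¹' c)),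
      isInvariantValuationRing_sInf (fun O hO => hc hO) hchain.symm,
      fun O hO => sInf_le (a := OrderDual.ofDual O) hO⟩
  obtain ⟨O', hO', hlt⟩ := IsInvariantValuationRing.exists_lt hO.prop hL hna hbd hsurj
  exact hlt.not_ge (hO.le_of_ge (y := OrderDual.toDual O') hO' hlt.le)

lemma boundedOverCenter_of_finiteDimensional (F D : Type*) [Field F] [DivisionRing D]
    [Algebra F D] [FiniteDimensional F D] : BoundedOverCenter D := by
  refine ⟨Module.finrank F D, fun t => ?_⟩
  have hdep : ¬ LinearIndependent F t := fun h => by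
    have := h.fintype_card_le_finrank
    simp at this
  obtain ⟨g, hg, i, hi⟩ := Fintype.not_linearIndependent_iff.1 hdep
  refine ⟨fun i => algebraMap F D (g i), fun i => ?_, fun h => hi ?_, ?_⟩
  · rw [Semigroup.mem_center_iff]
    exact fun a => (Algebra.commutes _ _).symm
  · simpa using congrFun h i
  · simpa only [Algebra.smul_def] using hg

/-! ### From the commuting graph to far pairs, and the theorem -/

section CommutingGraph

variable {X : Type*} [Group X]

lemma commutingGraph_edist_le_one {a b : {g : X // g ≠ 1}} (h : Commute (a : X) (b : X)) :
    (commutingGraph X).edist a b ≤ 1 := by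
  rw [SimpleGraph.edist_le_one_iff_adj_or_eq]
  by_cases hab : a = b
  · exact Or.inr hab
  · exact Or.inl ⟨hab, h⟩

lemma commutingGraph_edist_le_two {a c : {g : X // g ≠ 1}} {z : X} (hz : z ≠ 1)
    (h1 : Commute (a : X) z) (h2 : Commute z (c : X)) : (commutingGraph X).edist a c ≤ 2 := by
  refine (SimpleGraph.edist_triangle (v := ⟨z, hz⟩)).trans ?_
  exact (add_le_add (commutingGraph_edist_le_one h1) (commutingGraph_edist_le_one h2)).trans
    (by norm_num)

lemma commutingGraph_edist_le_three {a c : {g : X // g ≠ 1}} {u v : X} (hu : u ≠ 1) (hv : v ≠ 1)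
    (h1 : Commute (a : X) u) (h2 : Commute u v) (h3 : Commute v (c : X)) :
    (commutingGraph X).edist a c ≤ 3 := by
  refine (SimpleGraph.edist_triangle (v := ⟨u, hu⟩)).trans ?_
  exact (add_le_add (commutingGraph_edist_le_one h1)
    (commutingGraph_edist_le_two (a := ⟨u, hu⟩) hv h2 h3)).trans (by norm_num)

lemma commutingGraph_edist_le_four {a c : {g : X // g ≠ 1}} {u v w : X} (hu : u ≠ 1) (hv : v ≠ 1)
    (hw : w ≠ 1) (h1 : Commute (a : X) u) (h2 : Commute u v) (h3 : Commute v w)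
    (h4 : Commute w (c : X)) : (commutingGraph X).edist a c ≤ 4 := by
  refine (SimpleGraph.edist_triangle (v := ⟨u, hu⟩)).trans ?_
  exact (add_le_add (commutingGraph_edist_le_one h1)
    (commutingGraph_edist_le_three (a := ⟨u, hu⟩) hv hw h2 h3 h4)).trans (by norm_num)

lemma hasFarPair_of_ediam_or_balanced
    (h : 4 < (commutingGraph X).ediam ∨ CommutingGraphBalanced X) : HasFarPair X := by
  have hfar : ∀ x y : {g : X // g ≠ 1}, 3 < (commutingGraph X).edist x y →
      ∀ z, Commute (x : X) z → Commute z (y : X) → z = 1 := by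
    intro x y hxy z h1 h2
    by_contra hz
    exact absurd (hxy.trans_le (commutingGraph_edist_le_two hz h1 h2)) (by norm_num)
  rcases h with h | ⟨x, y, hm, hd, h1, -, -, h4, h5⟩
  · have : ∃ x y, 4 < (commutingGraph X).edist x y := by
      by_contra! hcon
      exact absurd (SimpleGraph.ediam_le_of_edist_le hcon) (not_le.2 h)
    obtain ⟨x, y, hxy⟩ := this
    refine ⟨x, y, x.2, y.2, hfar x y (lt_trans (by norm_num) hxy), Or.inl ?_⟩
    intro u v w hu hv hw c1 c2 c3 c4
    exact absurd (hxy.trans_le (commutingGraph_edist_le_four hu hv hw c1 c2 c3 c4)) (lt_irrefl _)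
  · refine ⟨x, y, x.2, y.2, hfar x y h1, Or.inr ⟨?_, ?_⟩⟩
    · intro u v hu hv c1 c2 c3
      exact absurd (h4.trans_le (commutingGraph_edist_le_three hu hv c1 c2 c3)) (lt_irrefl _)
    · intro u v hu hv c1 c2 c3
      exact absurd (h5.trans_le (commutingGraph_edist_le_three hu hv c1 c2 c3)) (lt_irrefl _)

end CommutingGraph

/-- Extension by zero of a homomorphism from the group of units of a division ring. -/
lemma exists_monoidWithZeroHom_of_units {D L : Type*} [DivisionRing D] [Group L] (φ : Dˣ →* L)
    (hφ : Function.Surjective φ) : ∃ π : D →*₀ WithZero L, Function.Surjective π := by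
  classical
  refine ⟨{ toFun := fun t => if h : t = 0 then 0 else (φ (Units.mk0 t h) : WithZero L)
            map_zero' := dif_pos rfl
            map_one' := ?_
            map_mul' := fun a b => ?_ }, fun z => ?_⟩
  · rw [dif_neg one_ne_zero, Units.mk0_one, map_one, WithZero.coe_one]
  · by_cases ha : a = 0
    · simp [ha]
    by_cases hb : b = 0
    · simp [hb]
    rw [dif_neg ha, dif_neg hb, dif_neg (mul_ne_zero ha hb), ← WithZero.coe_mul, ← map_mul,
      Units.mk0_mul]
  · by_cases hz : z = 0
    · exact ⟨0, by rw [hz, map_zero]⟩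
    · obtain ⟨l, rfl⟩ := WithZero.ne_zero_iff_exists.1 hz
      obtain ⟨u, rfl⟩ := hφ l
      refine ⟨u, ?_⟩
      show (if h : (u : D) = 0 then 0 else (φ (Units.mk0 (u : D) h) : WithZero L)) = _
      rw [dif_neg u.ne_zero, Units.mk0_val]

theorem theoremA {L : Type*} [Group L] [Finite L] [IsSimpleGroup L]
    (hna : ¬ ∀ a b : L, a * b = b * a)
    (hL : 4 < (commutingGraph L).ediam ∨ CommutingGraphBalanced L)
    {F D : Type*} [Field F] [DivisionRing D] [Algebra F D] [FiniteDimensional F D] :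
    ¬ ∃ (N : Subgroup Dˣ) (_ : N.Normal), Nonempty ((Dˣ ⧸ N) ≃* L) := by
  rintro ⟨N, hN, ⟨e⟩⟩
  obtain ⟨π, hπ⟩ := exists_monoidWithZeroHom_of_units
    (e.toMonoidHom.comp (QuotientGroup.mk' N))
    (e.surjective.comp (QuotientGroup.mk'_surjective N))
  exact not_surjective_of_hasFarPair (hasFarPair_of_ediam_or_balanced hL) hna
    (boundedOverCenter_of_finiteDimensional F D) π hπ
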